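/- Let $B,C>0$, $b>1$, $\lambda>0$, $0<\epsilon<\tfrac12$, $\Omega=(-1,1)^2$ and $\mathcal{L}_b=b^{-2}\partial_{xx}+\partial_{yy}$. Let $T_\epsilon(t)=(1+t)/\epsilon$ for $-1\le t\le -1+\epsilon$, $T_\epsilon(t)=1$ for $|t|\le 1-\epsilon$, and $T_\epsilon(t)=(1-t)/\epsilon$ for $1-\epsilon\le t\le 1$. Define the boundary data on $\partial\Omega$ by $$P_{bc}(\pm1,y)=\frac{B}{2C}\begin{pmatrix}-T_\epsilon(y)&0\\0&T_\epsilon(y)\end{pmatrix},\qquad P_{bc}(x,\pm1)=\frac{B}{2C}\begin{pmatrix}T_\epsilon(x)&0\\0&-T_\epsilon(x)\end{pmatrix}.$$ Let $\mathcal{A}$ be the set of all $P\in H^1(\Omega;S_0)$ with $P=P_{bc}$ on $\partial\Omega$ in the Sobolev sense, where $S_0$ is the space of symmetric traceless real $2\times2$ matrices, with norm $|P|=\sqrt{\operatorname{tr}(P^2)}$; write $\|P\|_{L^\infty}=\operatorname{ess\,sup}_\Omega|P|$. Consider, in the weak sense, the rescaled reduced Landau--de Gennes Euler--Lagrange system $$\mathcal{L}_bP_{1i}=\lambda^2\Big(P_{11}^2+P_{12}^2-\frac{B^2}{4C^2}\Big)P_{1i}\quad\text{in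 }\Omega,\qquad i=1,2,\tag{EL}$$ and the linear problem $$\mathcal{L}_b(P_0)_{1i}=0\quad\text{in }\Omega,\qquad i=1,2.\tag{L}$$ Then: (1) for each $b$ and $\epsilon$ the problem (L) has exactly one weak solution $P_0\in\mathcal{A}$ (up to equality almost everywhere); (2) there is a constant $\hat C>0$ depending only on $B$ and $C$ (in particular not on $\lambda$, $b$ or $\epsilon$) such that every weak solution $P\in\mathcal{A}$ of (EL) satisfies $$\|P-P_0\|_{L^\infty}\le\hat C\lambda^2;$$ (3) consequently, for fixed $b$ and $\epsilon$, solutions $P=P^{(\lambda)}$ of (EL) satisfy $\|P^{(\lambda)}-P_0\|_{L^\infty}\to0$ as $\lambda\to0^+$; and for fixed $S>0$ and $\epsilon$, solutions $P=P^{(b)}$ of (EL) with $\lambda=\sqrt{S/(4b)}$ (that is, with $4\lambda^2b=S$) satisfy $\|P^{(b)}-P_0^{(b)}\|_{L^\infty}\to0$ as $b\to\infty$, where $P_0^{(b)}$ is the solution of (L) for the parameter $b$. -/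

import Mathlib

open MeasureTheory Filter Topology
open scoped ContDiff ENNReal

noncomputable section

namespace RLdG

/-- The rescaled domain: the (open) square `(-1,1) × (-1,1)`. -/
def Omega : Set (ℝ × ℝ) := Set.Ioo (-1) 1 ×ˢ Set.Ioo (-1) 1

/-- Lebesgue measure on the square. -/
def area : Measure (ℝ × ℝ) := volume.restrict Omega

/-- Classical partial derivative in `x`. -/
def dx (φ : ℝ × ℝ → ℝ) (z : ℝ × ℝ) : ℝ := fderiv ℝ φ z (1, 0)

/-- Classical partial derivative in `y`. -/
def dy (φ : ℝ × ℝ → ℝ) (z : ℝ × ℝ) : ℝ := fderiv ℝ φ z (0, 1)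

/-- Test functions: `φ ∈ C_c^∞(Ω)`. -/
structure IsTest (φ : ℝ × ℝ → ℝ) : Prop where
  smooth : ContDiff ℝ ∞ φ
  compact : HasCompactSupport φ
  support : tsupport φ ⊆ Omega

/-- `u ∈ H¹(Ω)` with weak partial derivatives `ux = ∂ₓ u`, `uy = ∂_y u` in `L²(Ω)`. -/
structure HasH1Grad (u ux uy : ℝ × ℝ → ℝ) : Prop where
  memLp : MemLp u 2 area
  memLp_x : MemLp ux 2 area
  memLp_y : MemLp uy 2 area
  weak_x : ∀ φ, IsTest φ → ∫ z, u z * dx φ z ∂area = - ∫ z, ux z * φ z ∂area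
  weak_y : ∀ φ, IsTest φ → ∫ z, u z * dy φ z ∂area = - ∫ z, uy z * φ z ∂area

/-- The Sobolev space `H¹(Ω)`. -/
def MemH1 (u : ℝ × ℝ → ℝ) : Prop := ∃ ux uy, HasH1Grad u ux uy

/-- The space `H¹₀(Ω)`: the closure of `C_c^∞(Ω)` in `H¹(Ω)`. -/
def MemH10 (u : ℝ × ℝ → ℝ) : Prop :=
  ∃ ux uy, HasH1Grad u ux uy ∧ ∃ φ : ℕ → ℝ × ℝ → ℝ, (∀ n, IsTest (φ n)) ∧
    Tendsto (fun n => eLpNorm (fun z => φ n z - u z) 2 area) atTop (𝓝 0) ∧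
    Tendsto (fun n => eLpNorm (fun z => dx (φ n) z - ux z) 2 area) atTop (𝓝 0) ∧
    Tendsto (fun n => eLpNorm (fun z => dy (φ n) z - uy z) 2 area) atTop (𝓝 0)

/-- `u = g` on `∂Ω` in the Sobolev sense, for continuous boundary data `g`: `u` differs by an
element of `H¹₀(Ω)` from a function in `H¹(Ω) ∩ C(closure Ω)` which equals `g` at every point
of `∂Ω`. -/
def HasBoundaryValues (u g : ℝ × ℝ → ℝ) : Prop :=
  ∃ G : ℝ × ℝ → ℝ, MemH1 G ∧ ContinuousOn G (closure Omega) ∧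
    (∀ z ∈ frontier Omega, G z = g z) ∧ MemH10 (fun z => u z - G z)

/-- `u ∈ H¹(Ω)` is a weak solution of `b⁻² ∂ₓₓ u + ∂_yy u = f` in `Ω`. -/
def SolvesWeakly (b : ℝ) (u f : ℝ × ℝ → ℝ) : Prop :=
  ∃ ux uy, HasH1Grad u ux uy ∧ ∀ φ, IsTest φ →
    ∫ z, (1 / b ^ 2 * ux z * dx φ z + uy z * dy φ z) ∂area = - ∫ z, f z * φ z ∂area

/-- Fields of `2 × 2` matrices; only the values in `Ω`, up to null sets, matter. -/
abbrev Field := ℝ × ℝ → Matrix (Fin 2) (Fin 2) ℝ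

/-- The symmetric traceless `2 × 2` matrices. -/
def S0 : Set (Matrix (Fin 2) (Fin 2) ℝ) := {M | M.IsSymm ∧ M.trace = 0}

/-- The trapezoidal interpolation function on `[-1,1]`. -/
def trapezoid (ε t : ℝ) : ℝ :=
  if t ≤ -1 + ε then (1 + t) / ε else if t ≤ 1 - ε then 1 else (1 - t) / ε

/-- The tangent boundary data on the boundary of the square: `(B/2C) diag(-T(y), T(y))` on the
sides `x = ±1` and `(B/2C) diag(T(x), -T(x))` on the sides `y = ±1` (both vanish at the
corners). -/
def boundaryData (B C ε : ℝ) : Field := fun z =>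
  if |z.1| = 1 then (B / (2 * C)) • !![-trapezoid ε z.2, 0; 0, trapezoid ε z.2]
  else (B / (2 * C)) • !![trapezoid ε z.1, 0; 0, -trapezoid ε z.1]

/-- The admissible space `{P ∈ H¹(Ω; S₀) : P = P_bc on ∂Ω}`. -/
structure Admissible (B C ε : ℝ) (P : Field) : Prop where
  memH1 : ∀ i j, MemH1 (fun z => P z i j)
  mem_S0 : ∀ᵐ z ∂area, P z ∈ S0
  boundary : ∀ i j, HasBoundaryValues (fun z => P z i j) (fun z => boundaryData B C ε z i j)

/-- The Euler–Lagrange system of the rescaled reduced Landau–de Gennes energy, in weak form.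
(The right-hand sides lie in `L²(Ω)` because `H¹(Ω) ⊆ L⁶(Ω)` in dimension two.) -/
def SolvesEulerLagrange (B C b lam : ℝ) (P : Field) : Prop :=
  SolvesWeakly b (fun z => P z 0 0)
    (fun z => lam ^ 2 * ((P z 0 0) ^ 2 + (P z 0 1) ^ 2 - B ^ 2 / (4 * C ^ 2)) * P z 0 0) ∧
  SolvesWeakly b (fun z => P z 0 1)
    (fun z => lam ^ 2 * ((P z 0 0) ^ 2 + (P z 0 1) ^ 2 - B ^ 2 / (4 * C ^ 2)) * P z 0 1)

/-- `P` is a solution of the Euler–Lagrange boundary value problem. -/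
def IsELSolution (B C ε b lam : ℝ) (P : Field) : Prop :=
  Admissible B C ε P ∧ SolvesEulerLagrange B C b lam P

/-- `P₀` is a solution of the linear problem `b⁻² ∂ₓₓ P₀ + ∂_yy P₀ = 0` with the same
boundary data. -/
def IsLinearSolution (B C ε b : ℝ) (P₀ : Field) : Prop :=
  Admissible B C ε P₀ ∧
    SolvesWeakly b (fun z => P₀ z 0 0) (fun _ => 0) ∧
    SolvesWeakly b (fun z => P₀ z 0 1) (fun _ => 0)

/-- The norm `|M| = √(tr(M M))` of a symmetric matrix. -/
def tensorNorm (M : Matrix (Fin 2) (Fin 2) ℝ) : ℝ := √((M * M).trace)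

/-- The norm `‖P‖_{L^∞(Ω)} = ess sup_Ω |P|`, with values in `[0, ∞]`. -/
def linftyNorm (P : Field) : ℝ≥0∞ := essSup (fun z => ENNReal.ofReal (tensorNorm (P z))) area

end RLdG

end

/-! ### The square and its area measure -/

namespace RLdG

/-! Put `K = B / (2 * C)`. Everything rests on a weak maximum principle for the scalar operator `b⁻²
∂ₓₓ + ∂_yy`, used twice. The reaction term `λ²(P₁₁² + P₁₂² - K²) P₁ᵢ` has the sign of `P₁ᵢ` as soon
as `|P₁ᵢ| > K`, whatever the other component is, and the boundary data lie in `[-K, K]`. Hence both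
components of a solution stay in `[-K, K]` (`IsELSolution.abs_le`), and the reaction term is at most
`M = λ² K³` in absolute value.

Each component of `P - P₀` then has zero boundary values and a right-hand side bounded by `M`.
Comparison with the barrier `M / 2 * (1 - y²)` bounds it by `M / 2` (`SolvesWeakly.sub_le`). The
barrier depends on `y` alone, where the coefficient of the operator is `1`, so `b` does not enter;
the bound on the boundary data is independent of `ε`. Since `|P|² = 2(P₁₁² + P₁₂²)`, the norm is at
most `M`, and `Ĉ = K³` works. Both limits follow because `λ² → 0`. The case `M = 0` of the
comparison is uniqueness for (L); existence is an orthogonal projection of gradients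
(`exists_solvesWeakly`).

The technical weight is in the maximum principle `SolvesWeakly.ae_le`. The weak equation accepts
only smooth compactly supported test functions, so `u` is replaced by smooth `wₙ` converging to it,
with gradients, and nearly below `K` close to the boundary. A smooth truncation `γ(wₙ)` is then
admissible, and the error made in the energy identity is controlled by `∇wₙ - ∇u`. The cubic term is
a priori only integrable, through the Sobolev embedding into `L³`; this suffices because `γ` is
bounded. -/

theorem isOpen_Omega : IsOpen Omega := isOpen_Ioo.prod isOpen_Ioo

theorem measurableSet_Omega : MeasurableSet Omega := isOpen_Omega.measurableSet

theorem closure_Omega : closure Omega = Set.Icc (-1) 1 ×ˢ Set.Icc (-1) 1 := by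
  rw [Omega, closure_prod_eq, closure_Ioo (by norm_num)]

theorem isCompact_closure_Omega : IsCompact (closure Omega) := by
  rw [closure_Omega]; exact isCompact_Icc.prod isCompact_Icc

theorem isBounded_Omega : Bornology.IsBounded Omega :=
  isCompact_closure_Omega.isBounded.subset subset_closure

instance isFiniteMeasure_area : IsFiniteMeasure area :=
  ⟨by rw [area, Measure.restrict_apply_univ]; exact isBounded_Omega.measure_lt_top⟩

theorem ae_mem_Omega : ∀ᵐ z ∂area, z ∈ Omega := ae_restrict_mem measurableSet_Omega

theorem memLp_of_continuousOn {g : ℝ × ℝ → ℝ} (hg : ContinuousOn g (closure Omega)) (p : ℝ≥0∞) :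
    MemLp g p area := by
  obtain ⟨c, hc⟩ := isCompact_closure_Omega.exists_bound_of_continuousOn hg
  refine MemLp.of_bound ((hg.mono subset_closure).aestronglyMeasurable measurableSet_Omega) c ?_
  filter_upwards [ae_mem_Omega] with z hz using hc z (subset_closure hz)

theorem integral_area_eq {f : ℝ × ℝ → ℝ} (hf : ∀ z ∉ Omega, f z = 0) :
    ∫ z, f z ∂area = ∫ z, f z :=
  setIntegral_eq_integral_of_forall_compl_eq_zero hf

/-! ### Test functions and classical integration by parts -/

namespace IsTest

variable {φ ψ : ℝ × ℝ → ℝ}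

theorem contDiff_one (h : IsTest φ) : ContDiff ℝ 1 φ := h.smooth.of_le (by simp)

theorem eq_zero (h : IsTest φ) {z : ℝ × ℝ} (hz : z ∉ Omega) : φ z = 0 :=
  image_eq_zero_of_notMem_tsupport fun hh => hz (h.support hh)

theorem continuous_fderiv (h : IsTest φ) (v : ℝ × ℝ) : Continuous fun z => fderiv ℝ φ z v :=
  (h.contDiff_one.continuous_fderiv (by simp)).clm_apply continuous_const

theorem fderiv_eq_zero (h : IsTest φ) {z : ℝ × ℝ} (hz : z ∉ Omega) : fderiv ℝ φ z = 0 :=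
  image_eq_zero_of_notMem_tsupport fun hh => hz (h.support (tsupport_fderiv_subset ℝ hh))

theorem memLp (h : IsTest φ) (p : ℝ≥0∞) : MemLp φ p area :=
  memLp_of_continuousOn h.smooth.continuous.continuousOn p

theorem fderiv_memLp (h : IsTest φ) (v : ℝ × ℝ) (p : ℝ≥0∞) :
    MemLp (fun z => fderiv ℝ φ z v) p area :=
  memLp_of_continuousOn (h.continuous_fderiv v).continuousOn p

theorem dx_memLp (h : IsTest φ) (p : ℝ≥0∞) : MemLp (dx φ) p area := h.fderiv_memLp _ p

theorem dy_memLp (h : IsTest φ) (p : ℝ≥0∞) : MemLp (dy φ) p area := h.fderiv_memLp _ p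

theorem add (h : IsTest φ) (h' : IsTest ψ) : IsTest fun z => φ z + ψ z :=
  ⟨h.smooth.add h'.smooth, h.compact.add h'.compact,
    (tsupport_add φ ψ).trans (Set.union_subset h.support h'.support)⟩

theorem const_mul (h : IsTest φ) (c : ℝ) : IsTest fun z => c * φ z :=
  ⟨contDiff_const.mul h.smooth, h.compact.mul_left (f := fun _ => c),
    (tsupport_mul_subset_right (f := fun _ => c)).trans h.support⟩

theorem zero : IsTest fun _ => 0 :=
  ⟨contDiff_const, HasCompactSupport.zero, by
    have : tsupport (fun _ : ℝ × ℝ => (0 : ℝ)) = ∅ := tsupport_eq_empty_iff.2 rfl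
    simp [this]⟩

theorem fderiv_add (h : IsTest φ) (h' : IsTest ψ) (z v : ℝ × ℝ) :
    fderiv ℝ (fun z => φ z + ψ z) z v = fderiv ℝ φ z v + fderiv ℝ ψ z v := by
  rw [_root_.fderiv_fun_add (h.contDiff_one.differentiable (by simp) z)
    (h'.contDiff_one.differentiable (by simp) z)]; rfl

theorem fderiv_const_mul (h : IsTest φ) (c : ℝ) (z v : ℝ × ℝ) :
    fderiv ℝ (fun z => c * φ z) z v = c * fderiv ℝ φ z v := by
  rw [_root_.fderiv_const_mul (h.contDiff_one.differentiable (by simp) z)]; rfl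

theorem integral_mul_fderiv (h : IsTest φ) {g : ℝ × ℝ → ℝ} (hg : ContDiff ℝ 1 g) (v : ℝ × ℝ) :
    ∫ z, g z * fderiv ℝ φ z v ∂area = - ∫ z, fderiv ℝ g z v * φ z ∂area := by
  rw [integral_area_eq fun z hz => by simp [h.fderiv_eq_zero hz],
    integral_area_eq fun z hz => by simp [h.eq_zero hz]]
  have hcg : Continuous fun z => fderiv ℝ g z v :=
    (hg.continuous_fderiv (by simp)).clm_apply continuous_const
  refine integral_mul_fderiv_eq_neg_fderiv_mul_of_integrable ?_ ?_ ?_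
    (fun x _ => hg.differentiable (by simp) x) fun x _ => h.contDiff_one.differentiable (by simp) x
  · exact (hcg.mul h.smooth.continuous).integrable_of_hasCompactSupport h.compact.mul_left
  · exact (hg.continuous.mul (h.continuous_fderiv v)).integrable_of_hasCompactSupport
      (h.compact.fderiv_apply ℝ v).mul_left
  · exact (hg.continuous.mul h.smooth.continuous).integrable_of_hasCompactSupport h.compact.mul_left

end IsTest

/-- `C¹(ℝ²) ⊆ H¹(Ω)`. -/
theorem HasH1Grad.of_contDiff {g : ℝ × ℝ → ℝ} (hg : ContDiff ℝ 1 g) :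
    HasH1Grad g (dx g) (dy g) where
  memLp := memLp_of_continuousOn hg.continuous.continuousOn 2
  memLp_x := memLp_of_continuousOn
    ((hg.continuous_fderiv (by simp)).clm_apply continuous_const).continuousOn 2
  memLp_y := memLp_of_continuousOn
    ((hg.continuous_fderiv (by simp)).clm_apply continuous_const).continuousOn 2
  weak_x φ h := h.integral_mul_fderiv hg _
  weak_y φ h := h.integral_mul_fderiv hg _

/-! ### Linear structure of `H¹` and `H¹₀`, uniqueness of weak gradients -/

theorem integral_linear {a b : ℝ} {f g h : ℝ × ℝ → ℝ} (hf : MemLp f 2 area) (hg : MemLp g 2 area)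
    (hh : MemLp h 2 area) :
    ∫ z, (a * f z + b * g z) * h z ∂area = a * ∫ z, f z * h z ∂area + b * ∫ z, g z * h z ∂area := by
  rw [← integral_const_mul, ← integral_const_mul, ← integral_add]
  · congr 1; ext z; ring
  · exact (hf.integrable_mul hh).const_mul a
  · exact (hg.integrable_mul hh).const_mul b

theorem MemLp.linear {f g : ℝ × ℝ → ℝ} {p : ℝ≥0∞} (hf : MemLp f p area) (hg : MemLp g p area)
    (a b : ℝ) : MemLp (fun z => a * f z + b * g z) p area :=
  (hf.const_mul a).add (hg.const_mul b)

theorem HasH1Grad.linear {u ux uy v vx vy : ℝ × ℝ → ℝ} (hu : HasH1Grad u ux uy)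
    (hv : HasH1Grad v vx vy) (a b : ℝ) :
    HasH1Grad (fun z => a * u z + b * v z) (fun z => a * ux z + b * vx z)
      (fun z => a * uy z + b * vy z) where
  memLp := MemLp.linear hu.memLp hv.memLp a b
  memLp_x := MemLp.linear hu.memLp_x hv.memLp_x a b
  memLp_y := MemLp.linear hu.memLp_y hv.memLp_y a b
  weak_x φ h := by
    rw [integral_linear hu.memLp hv.memLp (h.dx_memLp 2),
      integral_linear hu.memLp_x hv.memLp_x (h.memLp 2), hu.weak_x φ h, hv.weak_x φ h]; ring
  weak_y φ h := by
    rw [integral_linear hu.memLp hv.memLp (h.dy_memLp 2),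
      integral_linear hu.memLp_y hv.memLp_y (h.memLp 2), hu.weak_y φ h, hv.weak_y φ h]; ring

theorem HasH1Grad.zero : HasH1Grad (fun _ => 0) (fun _ => 0) (fun _ => 0) := by
  have := (HasH1Grad.of_contDiff (g := fun _ => 0) contDiff_const).linear
    (HasH1Grad.of_contDiff (g := fun _ => 0) contDiff_const) 0 0
  simpa using this

theorem MemH1.linear {u v : ℝ × ℝ → ℝ} (hu : MemH1 u) (hv : MemH1 v) (a b : ℝ) :
    MemH1 fun z => a * u z + b * v z := by
  obtain ⟨_, _, hu⟩ := hu
  obtain ⟨_, _, hv⟩ := hv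
  exact ⟨_, _, hu.linear hv a b⟩

/-- The fundamental lemma of the calculus of variations, applied to `f - g`. -/
theorem ae_eq_of_forall_isTest {f g : ℝ × ℝ → ℝ} (hf : MemLp f 2 area) (hg : MemLp g 2 area)
    (h : ∀ φ, IsTest φ → ∫ z, f z * φ z ∂area = ∫ z, g z * φ z ∂area) : f =ᵐ[area] g := by
  have hfg : MemLp (fun z => f z - g z) 2 area := hf.sub hg
  have hi : IntegrableOn (fun z => f z - g z) Omega volume := hfg.integrable (by norm_num)
  have key := isOpen_Omega.ae_eq_zero_of_integral_contDiff_smul_eq_zero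
    (f := fun z => f z - g z) (μ := volume) hi.locallyIntegrableOn ?_
  · rw [Filter.EventuallyEq, area, ae_restrict_iff' measurableSet_Omega]
    filter_upwards [key] with z hz hzO using sub_eq_zero.1 (hz hzO)
  · intro φ h1 h2 h3
    have ht : IsTest φ := ⟨h1, h2, h3⟩
    rw [← integral_area_eq fun z hz => by simp [ht.eq_zero hz]]
    have := h φ ht
    rw [← sub_eq_zero, ← integral_sub] at this
    · rw [← this]; congr 1; ext z; simp; ring
    · exact hf.integrable_mul (ht.memLp 2)
    · exact hg.integrable_mul (ht.memLp 2)

/-- Weak gradients are hidden behind existential quantifiers in `MemH10`, `MemH1` and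
`SolvesWeakly`; this identifies the different choices. -/
theorem HasH1Grad.ae_eq {u ux uy vx vy : ℝ × ℝ → ℝ} (h : HasH1Grad u ux uy)
    (h' : HasH1Grad u vx vy) : ux =ᵐ[area] vx ∧ uy =ᵐ[area] vy := by
  refine ⟨ae_eq_of_forall_isTest h.memLp_x h'.memLp_x fun φ hφ => ?_,
    ae_eq_of_forall_isTest h.memLp_y h'.memLp_y fun φ hφ => ?_⟩
  · have h1 := h.weak_x φ hφ
    have h2 := h'.weak_x φ hφ
    linarith
  · have h1 := h.weak_y φ hφ
    have h2 := h'.weak_y φ hφ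
    linarith

theorem tendsto_eLpNorm_linear {f g : ℕ → ℝ × ℝ → ℝ} {F G : ℝ × ℝ → ℝ} {p : ℝ≥0∞} (hp : 1 ≤ p)
    (hf : ∀ n, MemLp (f n) p area) (hg : ∀ n, MemLp (g n) p area) (hF : MemLp F p area)
    (hG : MemLp G p area)
    (h : Tendsto (fun n => eLpNorm (fun z => f n z - F z) p area) atTop (𝓝 0))
    (h' : Tendsto (fun n => eLpNorm (fun z => g n z - G z) p area) atTop (𝓝 0)) (a b : ℝ) :
    Tendsto (fun n => eLpNorm (fun z => (a * f n z + b * g n z) - (a * F z + b * G z)) p area)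
      atTop (𝓝 0) := by
  have hle : ∀ n, eLpNorm (fun z => (a * f n z + b * g n z) - (a * F z + b * G z)) p area ≤
      ‖a‖ₑ * eLpNorm (fun z => f n z - F z) p area +
        ‖b‖ₑ * eLpNorm (fun z => g n z - G z) p area := fun n => by
    have e : (fun z => (a * f n z + b * g n z) - (a * F z + b * G z)) =
        (a • fun z => f n z - F z) + (b • fun z => g n z - G z) := by
      ext z; simp; ring
    rw [e, ← eLpNorm_const_smul, ← eLpNorm_const_smul]
    exact eLpNorm_add_le (((hf n).sub hF).const_smul a).1 (((hg n).sub hG).const_smul b).1 hp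
  refine tendsto_of_tendsto_of_tendsto_of_le_of_le tendsto_const_nhds ?_ (fun _ => zero_le) hle
  have := (ENNReal.Tendsto.const_mul h (Or.inr (enorm_ne_top (x := a)))).add
    (ENNReal.Tendsto.const_mul h' (Or.inr (enorm_ne_top (x := b))))
  simpa using this

theorem MemH10.linear {u v : ℝ × ℝ → ℝ} (hu : MemH10 u) (hv : MemH10 v) (a b : ℝ) :
    MemH10 fun z => a * u z + b * v z := by
  obtain ⟨ux, uy, hu, φ, hφ, h0, h1, h2⟩ := hu
  obtain ⟨vx, vy, hv, ψ, hψ, k0, k1, k2⟩ := hv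
  refine ⟨_, _, hu.linear hv a b, fun n z => a * φ n z + b * ψ n z,
    fun n => ((hφ n).const_mul a).add ((hψ n).const_mul b), ?_, ?_, ?_⟩
  · exact tendsto_eLpNorm_linear (by norm_num) (fun n => (hφ n).memLp 2) (fun n => (hψ n).memLp 2)
      hu.memLp hv.memLp h0 k0 a b
  · convert tendsto_eLpNorm_linear (by norm_num) (fun n => (hφ n).dx_memLp 2)
      (fun n => (hψ n).dx_memLp 2) hu.memLp_x hv.memLp_x h1 k1 a b using 5
    rw [dx, IsTest.fderiv_add ((hφ _).const_mul a) ((hψ _).const_mul b),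
      (hφ _).fderiv_const_mul, (hψ _).fderiv_const_mul]; rfl
  · convert tendsto_eLpNorm_linear (by norm_num) (fun n => (hφ n).dy_memLp 2)
      (fun n => (hψ n).dy_memLp 2) hu.memLp_y hv.memLp_y h2 k2 a b using 5
    rw [dy, IsTest.fderiv_add ((hφ _).const_mul a) ((hψ _).const_mul b),
      (hφ _).fderiv_const_mul, (hψ _).fderiv_const_mul]; rfl

theorem MemH10.zero : MemH10 fun _ => 0 :=
  ⟨_, _, HasH1Grad.zero, fun _ _ => 0, fun _ => IsTest.zero, by simp, by simp [dx], by simp [dy]⟩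

/-! ### Poincaré and Sobolev inequalities -/

open scoped Convolution NNReal

theorem abs_snd_le_one {z : ℝ × ℝ} (hz : z ∈ Omega) : |z.2| ≤ 1 :=
  abs_le.2 ⟨hz.2.1.le, hz.2.2.le⟩

/-- Poincaré's inequality on the square. -/
theorem IsTest.poincare {φ : ℝ × ℝ → ℝ} (h : IsTest φ) :
    ∫ z, φ z ^ 2 ∂area ≤ 4 * ∫ z, dy φ z ^ 2 ∂area := by
  have hd : ∀ z, dy (fun z => z.2 * φ z) z = φ z + z.2 * dy φ z := fun z => by
    have h1 : HasFDerivAt (fun z : ℝ × ℝ => z.2 * φ z) _ z :=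
      (hasFDerivAt_snd (𝕜 := ℝ) (p := z)).mul
        (h.contDiff_one.differentiable (by simp) z).hasFDerivAt
    rw [dy, h1.fderiv]; simp [dy]; ring
  -- Integrating `∂_y(yφ) φ` by parts gives `∫ φ² = -2 ∫ y φ ∂_yφ`. As `|y| ≤ 1`, the right side is
  -- at most `½ ∫ φ² + 2 ∫ (∂_yφ)²`, and half of `∫ φ²` is absorbed.
  have h1 := h.integral_mul_fderiv (contDiff_snd.mul h.contDiff_one) (0, 1)
  change ∫ z, z.2 * φ z * dy φ z ∂area = -∫ z, dy (fun z => z.2 * φ z) z * φ z ∂area at h1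
  simp only [hd] at h1
  have hyφ : MemLp (fun z => z.2 * φ z) 2 area :=
    memLp_of_continuousOn (continuous_snd.mul h.smooth.continuous).continuousOn 2
  have i1 : Integrable (fun z => φ z ^ 2) area := (h.memLp 2).integrable_sq
  have i2 : Integrable (fun z => z.2 * φ z * dy φ z) area := hyφ.integrable_mul (h.dy_memLp 2)
  have i3 : Integrable (fun z => dy φ z ^ 2) area := (h.dy_memLp 2).integrable_sq
  have h2 : ∫ z, (φ z + z.2 * dy φ z) * φ z ∂area =
      ∫ z, φ z ^ 2 ∂area + ∫ z, z.2 * φ z * dy φ z ∂area := by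
    rw [← integral_add i1 i2]; congr 1; ext z; ring
  have h3 : ∫ z, -2 * (z.2 * φ z * dy φ z) ∂area ≤
      ∫ z, (1 / 2 * φ z ^ 2 + 2 * dy φ z ^ 2) ∂area := by
    refine integral_mono_ae (i2.const_mul _) ((i1.const_mul _).add (i3.const_mul _)) ?_
    filter_upwards [ae_mem_Omega] with z hz
    have hy := abs_le.1 (abs_snd_le_one hz)
    have : z.2 ^ 2 ≤ 1 := by nlinarith
    nlinarith [sq_nonneg (φ z + 2 * z.2 * dy φ z), mul_nonneg (sub_nonneg.2 this) (sq_nonneg (dy φ z))]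
  rw [integral_const_mul, integral_add (i1.const_mul _) (i3.const_mul _), integral_const_mul,
    integral_const_mul] at h3
  linarith

/-- The plane carries the sup norm, whose dual norm is the `ℓ¹` norm of the partial derivatives. -/
theorem norm_fderiv_le (φ : ℝ × ℝ → ℝ) (z : ℝ × ℝ) : ‖fderiv ℝ φ z‖ ≤ ‖|dx φ z| + |dy φ z|‖ := by
  rw [Real.norm_of_nonneg (by positivity)]
  refine ContinuousLinearMap.opNorm_le_bound _ (by positivity) fun v => ?_
  have e : fderiv ℝ φ z v = v.1 * dx φ z + v.2 * dy φ z := by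
    have : v = v.1 • ((1 : ℝ), (0 : ℝ)) + v.2 • ((0 : ℝ), (1 : ℝ)) := by ext <;> simp
    conv_lhs => rw [this, map_add, map_smul, map_smul]
    rfl
  have h1 : |v.1| ≤ ‖v‖ := norm_fst_le v
  have h2 : |v.2| ≤ ‖v‖ := norm_snd_le v
  rw [e, Real.norm_eq_abs]
  calc |v.1 * dx φ z + v.2 * dy φ z| ≤ |v.1| * |dx φ z| + |v.2| * |dy φ z| := by
        rw [← abs_mul, ← abs_mul]; exact abs_add_le _ _
    _ ≤ ‖v‖ * |dx φ z| + ‖v‖ * |dy φ z| := by gcongr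
    _ = _ := by ring

theorem IsTest.exists_eLpNorm_le_fderiv {p q : ℝ≥0} (e1 : 1 ≤ p)
    (e2 : p < Module.finrank ℝ (ℝ × ℝ))
    (e3 : (p : ℝ)⁻¹ - (Module.finrank ℝ (ℝ × ℝ) : ℝ)⁻¹ ≤ (q : ℝ)⁻¹) : ∃ c : ℝ≥0, ∀ φ, IsTest φ →
    eLpNorm φ q area ≤ c * eLpNorm (fderiv ℝ φ) p area := by
  refine ⟨eLpNormLESNormFDerivOfLeConst ℝ volume Omega p q, fun φ h => ?_⟩
  have hs : Function.support (fderiv ℝ φ) ⊆ Omega :=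
    (subset_tsupport _).trans ((tsupport_fderiv_subset ℝ).trans h.support)
  rw [area, eLpNorm_restrict_eq_of_support_subset (f := fderiv ℝ φ) hs]
  exact (eLpNorm_mono_measure _ Measure.restrict_le_self).trans
    (eLpNorm_le_eLpNorm_fderiv_of_le volume h.contDiff_one
      ((subset_tsupport φ).trans h.support) e1 e2 e3 isBounded_Omega)

/-- The exponent `2` is critical in the plane, so a smaller one is taken: `2/3 - 1/2 = 1/6 ≤ 1/3`.
-/
theorem IsTest.exists_eLpNorm_three_le_fderiv : ∃ c : ℝ≥0, ∀ φ, IsTest φ →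
    eLpNorm φ 3 area ≤ c * eLpNorm (fderiv ℝ φ) (3 / 2 : ℝ≥0) area := by
  have e1 : (1 : ℝ≥0) ≤ 3 / 2 := by rw [← NNReal.coe_le_coe]; norm_num
  have e2 : (3 / 2 : ℝ≥0) < Module.finrank ℝ (ℝ × ℝ) := by
    rw [← NNReal.coe_lt_coe]; simp; norm_num
  have e3 : ((3 / 2 : ℝ≥0) : ℝ)⁻¹ - (Module.finrank ℝ (ℝ × ℝ) : ℝ)⁻¹ ≤ ((3 : ℝ≥0) : ℝ)⁻¹ := by
    simp; norm_num
  obtain ⟨c, hc⟩ := IsTest.exists_eLpNorm_le_fderiv e1 e2 e3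
  exact ⟨c, hc⟩

/-- The Sobolev inequality `‖φ‖_{L³} ≤ c ‖∇φ‖_{L²}` for test functions on the square. -/
theorem IsTest.exists_eLpNorm_three_le : ∃ c : ℝ≥0∞, c ≠ ⊤ ∧ ∀ φ, IsTest φ →
    eLpNorm φ 3 area ≤ c * (eLpNorm (dx φ) 2 area + eLpNorm (dy φ) 2 area) := by
  obtain ⟨c₁, hc₁⟩ := IsTest.exists_eLpNorm_three_le_fderiv
  -- The second factor is the Hölder constant for `L² ⊆ L^{3/2}` on a set of finite measure.
  refine ⟨c₁ * area Set.univ ^ (1 / ((3 / 2 : ℝ≥0) : ℝ≥0∞).toReal - 1 / (2 : ℝ≥0∞).toReal),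
    ENNReal.mul_ne_top ENNReal.coe_ne_top (ENNReal.rpow_ne_top_of_nonneg (by norm_num)
      (measure_ne_top _ _)), fun φ h => ?_⟩
  have hm : AEStronglyMeasurable (fderiv ℝ φ) area :=
    (h.contDiff_one.continuous_fderiv (by simp)).aestronglyMeasurable
  have hle : ((3 / 2 : ℝ≥0) : ℝ≥0∞) ≤ 2 := by
    rw [← ENNReal.coe_ofNat, ENNReal.coe_le_coe, ← NNReal.coe_le_coe]; norm_num
  have h3 := eLpNorm_le_eLpNorm_mul_rpow_measure_univ hle hm
  have h4 : eLpNorm (fderiv ℝ φ) 2 area ≤ eLpNorm (dx φ) 2 area + eLpNorm (dy φ) 2 area := by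
    refine (eLpNorm_mono (norm_fderiv_le φ)).trans ?_
    refine (eLpNorm_add_le (h.dx_memLp 2).1.norm (h.dy_memLp 2).1.norm (by norm_num)).trans ?_
    rw [eLpNorm_norm, eLpNorm_norm]
  refine (hc₁ φ h).trans ((mul_le_mul_right (h3.trans (mul_le_mul_left h4 _)) _).trans ?_)
  rw [mul_assoc, mul_comm (eLpNorm (dx φ) 2 area + _)]

theorem exists_subseq_tendsto_ae {f : ℕ → ℝ × ℝ → ℝ} {g : ℝ × ℝ → ℝ} {p : ℝ≥0∞} (hp : p ≠ 0)
    (hf : ∀ n, MemLp (f n) p area) (hg : MemLp g p area)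
    (h : Tendsto (fun n => eLpNorm (fun z => f n z - g z) p area) atTop (𝓝 0)) :
    ∃ ns : ℕ → ℕ, StrictMono ns ∧
      ∀ᵐ z ∂area, Tendsto (fun n => f (ns n) z) atTop (𝓝 (g z)) :=
  (tendstoInMeasure_of_tendsto_eLpNorm hp (fun n => (hf n).1) hg.1 h).exists_seq_tendsto_ae

theorem eventually_eLpNorm_le {f : ℕ → ℝ × ℝ → ℝ} {g : ℝ × ℝ → ℝ}
    (hf : ∀ n, MemLp (f n) 2 area) (hg : MemLp g 2 area)
    (h : Tendsto (fun n => eLpNorm (fun z => f n z - g z) 2 area) atTop (𝓝 0)) :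
    ∀ᶠ n in atTop, eLpNorm (f n) 2 area ≤ 1 + eLpNorm g 2 area := by
  filter_upwards [h.eventually (ge_mem_nhds one_pos)] with n hn
  have e : f n = (fun z => f n z - g z) + g := by ext z; simp
  rw [e]
  exact (eLpNorm_add_le ((hf n).sub hg).1 hg.1 (by norm_num)).trans (add_le_add_left hn _)

/-- Fatou's lemma along an a.e. convergent subsequence of test functions, whose `L³` norms are
bounded by the Sobolev inequality. -/
theorem MemH10.memLp_three {v : ℝ × ℝ → ℝ} (h : MemH10 v) : MemLp v 3 area := by
  obtain ⟨vx, vy, hv, φ, hφ, h0, h1, h2⟩ := h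
  obtain ⟨c, hct, hc⟩ := IsTest.exists_eLpNorm_three_le
  obtain ⟨ns, hns, hae⟩ := exists_subseq_tendsto_ae (by norm_num) (fun n => (hφ n).memLp 2)
    hv.memLp h0
  refine ⟨hv.memLp.1, (Lp.eLpNorm_lim_le_liminf_eLpNorm (fun n => ((hφ (ns n)).memLp 3).1) v
    hae).trans_lt ?_⟩
  have hb := ((eventually_eLpNorm_le (fun n => (hφ n).dx_memLp 2) hv.memLp_x h1).and
    (eventually_eLpNorm_le (fun n => (hφ n).dy_memLp 2) hv.memLp_y h2))
  have hb' : ∀ᶠ n in atTop, eLpNorm (φ (ns n)) 3 area ≤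
      c * ((1 + eLpNorm vx 2 area) + (1 + eLpNorm vy 2 area)) := by
    filter_upwards [hns.tendsto_atTop.eventually hb] with n hn
    exact (hc _ (hφ _)).trans (mul_le_mul_right (add_le_add hn.1 hn.2) _)
  refine (liminf_le_of_frequently_le' hb'.frequently).trans_lt ?_
  refine ENNReal.mul_lt_top hct.lt_top ?_
  simp [ENNReal.add_lt_top, hv.memLp_x.2, hv.memLp_y.2]

theorem HasBoundaryValues.memLp_three {u g : ℝ × ℝ → ℝ} (h : HasBoundaryValues u g) :
    MemLp u 3 area := by
  obtain ⟨G, -, hG, -, h0⟩ := h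
  have := h0.memLp_three.add (memLp_of_continuousOn hG 3)
  convert this using 1
  ext z; simp

/-! ### Smooth approximation by dilated mollification -/

/-- Mollification of a function on the plane. -/
noncomputable def mollify (ρ : ContDiffBump (0 : ℝ × ℝ)) (g : ℝ × ℝ → ℝ) : ℝ × ℝ → ℝ :=
  ρ.normed volume ⋆[ContinuousLinearMap.lsmul ℝ ℝ, volume] g

theorem mollify_apply (ρ : ContDiffBump (0 : ℝ × ℝ)) (g : ℝ × ℝ → ℝ) (z : ℝ × ℝ) :
    mollify ρ g z = ∫ s, ρ.normed volume s * g (z - s) := rfl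

theorem mollify_apply_swap (ρ : ContDiffBump (0 : ℝ × ℝ)) (g : ℝ × ℝ → ℝ) (z : ℝ × ℝ) :
    mollify ρ g z = ∫ s, ρ.normed volume (z - s) * g s := convolution_eq_swap _

theorem contDiff_mollify (ρ : ContDiffBump (0 : ℝ × ℝ)) {g : ℝ × ℝ → ℝ}
    (hg : LocallyIntegrable g) : ContDiff ℝ ∞ (mollify ρ g) :=
  ρ.hasCompactSupport_normed.contDiff_convolution_left _ ρ.contDiff_normed hg

/-- The derivative falls on the kernel, so no regularity of `g` is required. -/
theorem fderiv_mollify (ρ : ContDiffBump (0 : ℝ × ℝ)) {g : ℝ × ℝ → ℝ} (hg : LocallyIntegrable g)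
    (z v : ℝ × ℝ) :
    fderiv ℝ (mollify ρ g) z v = ∫ s, g s * fderiv ℝ (ρ.normed volume) (z - s) v := by
  have hρ : ContDiff ℝ 1 (ρ.normed (volume : Measure (ℝ × ℝ))) := ρ.contDiff_normed
  have h := ρ.hasCompactSupport_normed.hasFDerivAt_convolution_left (μ := volume)
    (ContinuousLinearMap.lsmul ℝ ℝ) hρ hg z
  have hi := ((ρ.hasCompactSupport_normed (μ := volume)).fderiv ℝ).convolutionExists_left
    ((ContinuousLinearMap.lsmul ℝ ℝ).precompL (ℝ × ℝ)) (hρ.continuous_fderiv (by simp)) hg z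
  rw [mollify, h.fderiv, convolution_eq_swap, ContinuousLinearMap.integral_apply hi.integrable_swap]
  congr 1; ext s
  simp [ContinuousLinearMap.precompL_apply, mul_comm]

/-- Mollification does not increase the `L²` norm. -/
theorem eLpNorm_mollify_le (ρ : ContDiffBump (0 : ℝ × ℝ)) {f : ℝ × ℝ → ℝ}
    (hf : AEStronglyMeasurable f volume) :
    eLpNorm (mollify ρ f) 2 volume ≤ eLpNorm f 2 volume := by
  have hmeas : Measurable fun s => ‖ρ.normed (volume : Measure (ℝ × ℝ)) s‖ₑ :=
    (ρ.contDiff_normed (n := 0)).continuous.measurable.enorm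
  -- The kernel is the density of a probability measure, so the `L¹` norm of a translate is at most
  -- its `L²` norm.
  set ν : Measure (ℝ × ℝ) := volume.withDensity fun s => ‖ρ.normed volume s‖ₑ with hν
  have hνp : IsProbabilityMeasure ν := ⟨by
    rw [hν, withDensity_apply _ MeasurableSet.univ, Measure.restrict_univ,
      ← ofReal_integral_norm_eq_lintegral_enorm ρ.integrable_normed]
    simp_rw [Real.norm_of_nonneg (ρ.nonneg_normed _)]
    rw [ρ.integral_normed]; simp⟩
  have hac : ν ≪ volume := withDensity_absolutelyContinuous _ _
  have hsl : ∀ z, AEStronglyMeasurable (fun s => f (z - s)) ν := fun z =>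
    (hf.comp_quasiMeasurePreserving
      (quasiMeasurePreserving_sub_left_of_right_invariant volume z)).mono_ac hac
  have hpt : ∀ z, ‖mollify ρ f z‖ₑ ^ (2 : ℝ) ≤ ∫⁻ s, ‖f (z - s)‖ₑ ^ (2 : ℝ) ∂ν := fun z => by
    have h1 : ‖mollify ρ f z‖ₑ ≤ eLpNorm (fun s => f (z - s)) 1 ν := by
      rw [mollify_apply, eLpNorm_one_eq_lintegral_enorm]
      refine (enorm_integral_le_lintegral_enorm _).trans (le_of_eq ?_)
      rw [hν, lintegral_withDensity_eq_lintegral_mul₀' hmeas.aemeasurable (hsl z).enorm]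
      simp [enorm_mul]
    have h2 := h1.trans (eLpNorm_le_eLpNorm_of_exponent_le (q := 2) (by norm_num) (hsl z))
    have h3 := ENNReal.rpow_le_rpow h2 (z := 2) (by norm_num)
    rwa [eLpNorm_eq_lintegral_rpow_enorm_toReal (by norm_num) (by norm_num), ← ENNReal.rpow_mul,
      ENNReal.toReal_ofNat, one_div, inv_mul_cancel₀ (by norm_num), ENNReal.rpow_one] at h3
  have hprod : AEMeasurable (fun p : (ℝ × ℝ) × (ℝ × ℝ) => ‖f (p.1 - p.2)‖ₑ ^ (2 : ℝ))
      (volume.prod ν) :=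
    (hf.comp_quasiMeasurePreserving
      (quasiMeasurePreserving_sub_of_right_invariant volume ν)).enorm.pow_const _
  rw [eLpNorm_eq_lintegral_rpow_enorm_toReal (by norm_num) (by norm_num),
    eLpNorm_eq_lintegral_rpow_enorm_toReal (by norm_num) (by norm_num), ENNReal.toReal_ofNat]
  refine ENNReal.rpow_le_rpow ?_ (by norm_num)
  refine (lintegral_mono hpt).trans ?_
  -- Tonelli, then translation invariance of Lebesgue measure removes the shift.
  rw [lintegral_lintegral_swap hprod]
  simp_rw [lintegral_sub_right_eq_self (μ := volume) (fun z => ‖f z‖ₑ ^ (2 : ℝ))]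
  simp

/-- Change of variables in the plane gives the factor `(t⁻²)^{1/2} = t⁻¹ ≤ 2`. -/
theorem eLpNorm_comp_smul_le {f : ℝ × ℝ → ℝ} (hf : AEStronglyMeasurable f volume) {t : ℝ}
    (ht : 1 / 2 ≤ t) : eLpNorm (fun z => f (t • z)) 2 volume ≤ 2 * eLpNorm f 2 volume := by
  have ht0 : t ≠ 0 := by linarith
  have hmap : Measure.map (fun z : ℝ × ℝ => t • z) volume =
      ENNReal.ofReal |(t ^ Module.finrank ℝ (ℝ × ℝ))⁻¹| • volume := Measure.map_addHaar_smul _ ht0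
  have hc : ENNReal.ofReal |(t ^ Module.finrank ℝ (ℝ × ℝ))⁻¹| ≠ 0 := by
    rw [Ne, ENNReal.ofReal_eq_zero, not_le]; positivity
  have h := eLpNorm_map_measure (p := 2) (g := f) (f := fun z : ℝ × ℝ => t • z) (μ := volume)
    (by rw [hmap]; exact hf.smul_measure _) (measurable_const_smul t).aemeasurable
  change _ = eLpNorm (fun z => f (t • z)) 2 volume at h
  rw [← h, hmap, eLpNorm_smul_measure_of_ne_zero hc, smul_eq_mul]
  refine mul_le_mul_left ?_ _
  have h4 : ENNReal.ofReal |(t ^ Module.finrank ℝ (ℝ × ℝ))⁻¹| ≤ ((2 : ℝ≥0∞) ^ (2 : ℝ)) := by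
    have : |(t ^ Module.finrank ℝ (ℝ × ℝ))⁻¹| ≤ 4 := by
      rw [abs_of_nonneg (by positivity)]
      refine inv_le_of_inv_le₀ (by norm_num) ?_
      simp
      nlinarith
    refine (ENNReal.ofReal_le_ofReal this).trans ?_
    norm_num
  refine (ENNReal.rpow_le_rpow h4 (by simp)).trans (le_of_eq ?_)
  rw [← ENNReal.rpow_mul]; simp

/-- In the sup norm the square is the unit ball, so shrinking towards the origin moves its closure
into its interior. -/
theorem Omega_eq_ball : Omega = Metric.ball (0 : ℝ × ℝ) 1 := by
  rw [Omega, ← Prod.mk_zero_zero, ← ball_prod_same, Real.ball_eq_Ioo]; norm_num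

theorem closure_Omega_eq : closure Omega = Metric.closedBall (0 : ℝ × ℝ) 1 := by
  rw [Omega_eq_ball, closure_ball _ one_ne_zero]

theorem dist_smul_self_le {t : ℝ} (ht : t ≤ 1) {z : ℝ × ℝ} (hz : ‖z‖ ≤ 1) :
    dist (t • z) z ≤ 1 - t := by
  have : t • z - z = (t - 1) • z := by module
  rw [dist_eq_norm, this, norm_smul, Real.norm_eq_abs, abs_of_nonpos (by linarith)]
  nlinarith [norm_nonneg z]

/-- If `g` is uniformly continuous at scale `2δ`, its dilated mollification is close to it. -/
theorem abs_mollify_smul_sub_le {g : ℝ × ℝ → ℝ} {η δ : ℝ}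
    (hm : AEStronglyMeasurable g volume)
    (hg : ∀ x y, dist x y < 2 * δ → |g x - g y| ≤ η)
    (ρ : ContDiffBump (0 : ℝ × ℝ)) (hρ : ρ.rOut < δ) {t : ℝ} (h1 : t ≤ 1)
    (h2 : 1 - δ < t) {z : ℝ × ℝ} (hz : ‖z‖ ≤ 1) :
    |mollify ρ g (t • z) - g z| ≤ 2 * η := by
  have ha : |mollify ρ g (t • z) - g (t • z)| ≤ η :=
    ρ.dist_normed_convolution_le hm fun x hx =>
      hg _ _ (by
        have := Metric.mem_ball.1 hx; linarith [ρ.rOut_pos])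
  have hb : |g (t • z) - g z| ≤ η := by
    refine hg _ _ ?_
    have := dist_smul_self_le h1 hz
    linarith [ρ.rOut_pos]
  calc |mollify ρ g (t • z) - g z| ≤ |mollify ρ g (t • z) - g (t • z)| + |g (t • z) - g z| :=
        abs_sub_le _ _ _
    _ ≤ 2 * η := by linarith

theorem mollify_sub (ρ : ContDiffBump (0 : ℝ × ℝ)) {g h : ℝ × ℝ → ℝ} (hg : LocallyIntegrable g)
    (hh : LocallyIntegrable h) (z : ℝ × ℝ) :
    mollify ρ (g - h) z = mollify ρ g z - mollify ρ h z := by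
  have hρ : Continuous (ρ.normed (volume : Measure (ℝ × ℝ))) :=
    (ρ.contDiff_normed (n := 0)).continuous
  have key : ∀ {f : ℝ × ℝ → ℝ}, LocallyIntegrable f →
      Integrable fun s => ρ.normed volume s * f (z - s) := fun hf =>
    (ρ.hasCompactSupport_normed (μ := volume)).convolutionExists_left
      (ContinuousLinearMap.lsmul ℝ ℝ) hρ hf z
  simp only [mollify_apply]
  rw [← integral_sub (key hg) (key hh)]
  congr 1; ext s; simp; ring

/-- Dilated mollifications converge in `L²(Ω)`. -/
theorem tendsto_eLpNorm_mollify {g : ℝ × ℝ → ℝ} (hg : MemLp g 2 volume)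
    {ρ : ℕ → ContDiffBump (0 : ℝ × ℝ)} {t : ℕ → ℝ}
    (hρ : Tendsto (fun n => (ρ n).rOut) atTop (𝓝 0)) (ht : Tendsto t atTop (𝓝 1))
    (ht1 : ∀ n, t n ≤ 1) :
    Tendsto (fun n => eLpNorm (fun z => t n * mollify (ρ n) g (t n • z) - g z) 2 area)
      atTop (𝓝 0) := by
  rw [ENNReal.tendsto_nhds_zero]
  intro η hη
  -- Density of continuous compactly supported functions; `η / 8` leaves room for the factor `2` of
  -- the dilation.
  obtain ⟨h, hhs, hgh, hhc, hh⟩ := hg.exists_hasCompactSupport_eLpNorm_sub_le (ε := η / 8)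
    (by norm_num) (ENNReal.div_pos hη.ne' (by norm_num)).ne'
  -- A uniform error `c` on the square costs less than `η / 4` in `L²`.
  obtain ⟨c, hc0, hc⟩ := ENNReal.exists_nnreal_pos_mul_lt
    (a := area Set.univ ^ (2 : ℝ≥0∞).toReal⁻¹) (b := η / 4)
    (ENNReal.rpow_ne_top_of_nonneg (by simp) (measure_ne_top _ _))
    (ENNReal.div_pos hη.ne' (by norm_num)).ne'
  obtain ⟨δ, hδ, huc⟩ := Metric.uniformContinuous_iff.1
    (hhs.uniformContinuous_of_continuous hhc) (c / 2) (by positivity)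
  have hlast : Tendsto (fun n => ‖t n - 1‖ₑ * eLpNorm g 2 area) atTop (𝓝 0) := by
    have h1 : Tendsto (fun n => ‖t n - 1‖ₑ) atTop (𝓝 0) := by
      have := (ht.sub_const 1).enorm
      simpa using this
    have := ENNReal.Tendsto.mul_const h1 (b := eLpNorm g 2 area)
      (Or.inr (hg.restrict Omega).2.ne)
    simpa using this
  filter_upwards [hρ.eventually (gt_mem_nhds (half_pos hδ)),
    ht.eventually (lt_mem_nhds (show 1 - δ / 2 < 1 by linarith)),
    ht.eventually (lt_mem_nhds (show (1 / 2 : ℝ) < 1 by norm_num)),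
    hlast.eventually (ge_mem_nhds (ENNReal.div_pos hη.ne' (show (4 : ℝ≥0∞) ≠ ⊤ by norm_num)))]
    with n h1 h2 h3 h4
  have hgl : LocallyIntegrable g := hg.locallyIntegrable (by norm_num)
  have hhl : LocallyIntegrable h := hh.locallyIntegrable (by norm_num)
  have htn : ‖t n‖ₑ ≤ 1 := by
    rw [Real.enorm_eq_ofReal (by linarith)]
    exact (ENNReal.ofReal_le_ofReal (ht1 n)).trans (by simp)
  have hmc : Continuous fun z => mollify (ρ n) (g - h) (t n • z) :=
    (contDiff_mollify (ρ n) (hgl.sub hhl)).continuous.comp (continuous_const_smul _)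
  have hmh : Continuous fun z => mollify (ρ n) h (t n • z) :=
    (contDiff_mollify (ρ n) hhl).continuous.comp (continuous_const_smul _)
  -- The error splits into four pieces, each at most `η / 4` in `L²`: mollified `g - h`, the uniform
  -- error for `h`, `g - h` itself, and `(t n - 1) • g`.
  have e : (fun z => t n * mollify (ρ n) g (t n • z) - g z) =
      t n • ((fun z => mollify (ρ n) (g - h) (t n • z)) +
        ((fun z => mollify (ρ n) h (t n • z) - h z) - (g - h))) + (t n - 1) • g := by
    ext z
    simp [mollify_sub (ρ n) hgl hhl]; ring
  have a1 : eLpNorm (fun z => mollify (ρ n) (g - h) (t n • z)) 2 area ≤ η / 4 := by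
    refine (eLpNorm_mono_measure _ Measure.restrict_le_self).trans ?_
    refine (eLpNorm_comp_smul_le
      (contDiff_mollify (ρ n) (hgl.sub hhl)).continuous.aestronglyMeasurable h3.le).trans ?_
    refine (mul_le_mul_right ((eLpNorm_mollify_le (ρ n) (hg.sub hh).1).trans hgh) 2).trans ?_
    rw [show (8 : ℝ≥0∞) = 2 * 4 by norm_num, ENNReal.div_eq_inv_mul,
      ENNReal.mul_inv (by simp) (by simp), ← mul_assoc, ← mul_assoc,
      ENNReal.mul_inv_cancel (by simp) (by simp), one_mul, ENNReal.div_eq_inv_mul]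
  have a2 : eLpNorm (fun z => mollify (ρ n) h (t n • z) - h z) 2 area ≤ η / 4 := by
    refine (eLpNorm_le_of_ae_bound (C := c) ?_).trans ?_
    · filter_upwards [ae_mem_Omega] with z hz
      have hz1 : ‖z‖ ≤ 1 := by
        rw [Omega_eq_ball] at hz; exact (mem_ball_zero_iff.1 hz).le
      have := abs_mollify_smul_sub_le (η := c / 2) (δ := δ / 2)
        hhc.aestronglyMeasurable (fun x y hxy => by
          rw [← Real.dist_eq]; exact (huc (by linarith)).le) (ρ n) h1 (ht1 n) h2
        hz1
      rw [Real.norm_eq_abs]; linarith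
    · rw [ENNReal.ofReal_coe_nnreal, mul_comm]; exact hc.le
  have a3 : eLpNorm (g - h) 2 area ≤ η / 4 :=
    (eLpNorm_mono_measure _ Measure.restrict_le_self).trans
      (hgh.trans (ENNReal.div_le_div_left (by norm_num) _))
  have m1 := hmc.aestronglyMeasurable (μ := area)
  have m2 : AEStronglyMeasurable (fun z => mollify (ρ n) h (t n • z) - h z) area :=
    (hmh.sub hhc).aestronglyMeasurable
  have m3 : AEStronglyMeasurable (g - h) area := (hg.sub hh).1.mono_measure Measure.restrict_le_self
  have m4 : AEStronglyMeasurable g area := hg.1.mono_measure Measure.restrict_le_self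
  rw [e]
  refine (eLpNorm_add_le ((m1.add (m2.sub m3)).const_smul _) (m4.const_smul _)
    (by norm_num)).trans ?_
  rw [eLpNorm_const_smul, eLpNorm_const_smul]
  have a4 := (eLpNorm_add_le m1 (m2.sub m3) (p := 2) (by norm_num)).trans
    (add_le_add a1 ((eLpNorm_sub_le m2 m3 (by norm_num)).trans (add_le_add a2 a3)))
  calc _ ≤ 1 * (η / 4 + (η / 4 + η / 4)) + η / 4 := add_le_add (mul_le_mul' htn a4) h4
    _ = η / 4 * 4 := by ring
    _ ≤ η := (ENNReal.div_mul_cancel (by simp) (by simp)).le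

theorem memLp_indicator_Omega {g : ℝ × ℝ → ℝ} (hg : MemLp g 2 area) :
    MemLp (Omega.indicator g) 2 volume := (memLp_indicator_iff_restrict measurableSet_Omega).2 hg

/-- Away from the boundary, mollification commutes with weak differentiation. -/
theorem integral_indicator_mul_fderiv {G G' : ℝ × ℝ → ℝ} {v : ℝ × ℝ}
    (h : ∀ φ, IsTest φ → ∫ z, G z * fderiv ℝ φ z v ∂area = - ∫ z, G' z * φ z ∂area)
    (ρ : ContDiffBump (0 : ℝ × ℝ)) {z : ℝ × ℝ} (hz : Metric.closedBall z ρ.rOut ⊆ Omega) :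
    ∫ s, Omega.indicator G s * fderiv ℝ (ρ.normed volume) (z - s) v =
      mollify ρ (Omega.indicator G') z := by
  -- The reflected kernel centred at `z` is a test function because its ball lies in the square; the
  -- sign from the reflection cancels the sign of integration by parts.
  set φ : ℝ × ℝ → ℝ := fun s => ρ.normed volume (z - s) with hφ
  have hsm : ContDiff ℝ ∞ φ := ρ.contDiff_normed.comp (contDiff_const.sub contDiff_id)
  have hsupp : tsupport φ ⊆ Metric.closedBall z ρ.rOut := by
    refine closure_minimal (fun s hs => ?_) Metric.isClosed_closedBall
    have : z - s ∈ Metric.ball (0 : ℝ × ℝ) ρ.rOut := by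
      rw [← ρ.support_normed_eq (μ := volume)]; exact hs
    rw [mem_ball_zero_iff] at this
    rw [Metric.mem_closedBall, dist_comm, dist_eq_norm]
    exact this.le
  have hT : IsTest φ := ⟨hsm, HasCompactSupport.of_support_subset_isCompact
    (isCompact_closedBall z ρ.rOut) ((subset_tsupport φ).trans hsupp), hsupp.trans hz⟩
  have hd : ∀ s, fderiv ℝ φ s v = - fderiv ℝ (ρ.normed volume) (z - s) v := fun s => by
    have h1 : HasFDerivAt φ _ s := HasFDerivAt.comp (f := fun s => z - s) s
      ((ρ.contDiff_normed (n := 1)).differentiable (by simp) (z - s)).hasFDerivAt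
      ((hasFDerivAt_const z s).sub (hasFDerivAt_id s))
    rw [h1.fderiv]; simp
  have h1 := h φ hT
  simp only [hd, mul_neg, integral_neg, neg_inj] at h1
  rw [mollify_apply_swap]
  have e1 : ∀ s, Omega.indicator G s * fderiv ℝ (ρ.normed volume) (z - s) v =
      Omega.indicator (fun s => G s * fderiv ℝ (ρ.normed volume) (z - s) v) s := fun s => by
    by_cases hs : s ∈ Omega <;> simp [hs]
  have e2 : ∀ s, ρ.normed volume (z - s) * Omega.indicator G' s =
      Omega.indicator (fun s => G' s * φ s) s := fun s => by
    by_cases hs : s ∈ Omega <;> simp [hs, hφ, mul_comm]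
  simp only [e1, e2]
  rw [integral_indicator measurableSet_Omega, integral_indicator measurableSet_Omega]
  exact h1

/-- Functions in `H¹(Ω) ∩ C(closure Ω)` are limits of smooth functions on the plane, in `H¹(Ω)`
and uniformly on `closure Ω`. -/
theorem HasH1Grad.exists_contDiff_tendsto {G gx gy : ℝ × ℝ → ℝ} (h : HasH1Grad G gx gy)
    (hc : ContinuousOn G (closure Omega)) : ∃ g : ℕ → ℝ × ℝ → ℝ, (∀ n, ContDiff ℝ ∞ (g n)) ∧
      (∀ η > 0, ∀ᶠ n in atTop, ∀ z ∈ closure Omega, |g n z - G z| ≤ η) ∧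
      Tendsto (fun n => eLpNorm (fun z => dx (g n) z - gx z) 2 area) atTop (𝓝 0) ∧
      Tendsto (fun n => eLpNorm (fun z => dy (g n) z - gy z) 2 area) atTop (𝓝 0) := by
  -- With dilation factor `1 - 2r` and mollification radius `r`, the balls used for points of the
  -- closed square stay in norm at most `1 - r`, inside the open square.
  set r : ℕ → ℝ := fun n => 1 / ((n : ℝ) + 1) / 4 with hr
  have hr0 : ∀ n, 0 < r n := fun n => by positivity
  have hr1 : ∀ n, r n ≤ 1 / 4 := fun n => by
    have : 1 / ((n : ℝ) + 1) ≤ 1 := by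
      rw [div_le_one (by positivity)]; linarith [Nat.cast_nonneg (α := ℝ) n]
    simp only [hr]; linarith
  have hrt : Tendsto r atTop (𝓝 0) := by
    simpa only [zero_div] using (tendsto_one_div_add_atTop_nhds_zero_nat (𝕜 := ℝ)).div_const 4
  let ρ : ℕ → ContDiffBump (0 : ℝ × ℝ) := fun n => ⟨r n / 2, r n, half_pos (hr0 n), half_lt_self (hr0 n)⟩
  let t : ℕ → ℝ := fun n => 1 - 2 * r n
  have htt : Tendsto t atTop (𝓝 1) := by simpa using (hrt.const_mul 2).const_sub 1
  have ht1 : ∀ n, t n ≤ 1 := fun n => by simp only [t]; linarith [hr0 n]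
  have ht0 : ∀ n, 0 < t n := fun n => by simp only [t]; linarith [hr1 n]
  have hball : ∀ n z, ‖z‖ ≤ 1 → Metric.closedBall (t n • z) (ρ n).rOut ⊆ Omega := fun n z hz s hs => by
    rw [Omega_eq_ball, mem_ball_zero_iff]
    have h1 : ‖t n • z‖ ≤ t n := by
      rw [norm_smul, Real.norm_of_nonneg (ht0 n).le]; nlinarith [ht0 n]
    have h2 : ‖s - t n • z‖ ≤ r n := by rw [← dist_eq_norm]; exact hs
    have h3 := norm_add_le (s - t n • z) (t n • z)
    rw [sub_add_cancel] at h3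
    have : t n = 1 - 2 * r n := rfl
    linarith [hr0 n]
  have hG := memLp_indicator_Omega h.memLp
  have hGl : LocallyIntegrable (Omega.indicator G) := hG.locallyIntegrable (by norm_num)
  have hd : ∀ n z v, fderiv ℝ (fun z => mollify (ρ n) (Omega.indicator G) (t n • z)) z v =
      t n * fderiv ℝ (mollify (ρ n) (Omega.indicator G)) (t n • z) v := fun n z v => by
    have h1 := HasFDerivAt.comp (f := fun z : ℝ × ℝ => t n • z) z
      (((contDiff_mollify (ρ n) hGl).differentiable (by simp)) (t n • z)).hasFDerivAt
      ((hasFDerivAt_id z).const_smul (t n))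
    change HasFDerivAt (fun z => mollify (ρ n) (Omega.indicator G) (t n • z)) _ z at h1
    rw [h1.fderiv]; simp
  have hgrad : ∀ {G' : ℝ × ℝ → ℝ} {v : ℝ × ℝ}, MemLp G' 2 area →
      (∀ φ, IsTest φ → ∫ z, G z * fderiv ℝ φ z v ∂area = - ∫ z, G' z * φ z ∂area) →
      Tendsto (fun n => eLpNorm (fun z =>
        fderiv ℝ (fun z => mollify (ρ n) (Omega.indicator G) (t n • z)) z v - G' z) 2 area)
        atTop (𝓝 0) := by
    intro G' v hG' hw
    refine (tendsto_eLpNorm_mollify (ρ := ρ) (memLp_indicator_Omega hG') hrt htt ht1).congr fun n => ?_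
    refine eLpNorm_congr_ae ?_
    filter_upwards [ae_mem_Omega] with z hz
    have hz1 : ‖z‖ ≤ 1 := by rw [Omega_eq_ball] at hz; exact (mem_ball_zero_iff.1 hz).le
    rw [hd, fderiv_mollify _ hGl, integral_indicator_mul_fderiv hw (ρ n) (hball n z hz1),
      Set.indicator_of_mem hz]
  refine ⟨fun n z => mollify (ρ n) (Omega.indicator G) (t n • z), fun n =>
    (contDiff_mollify (ρ n) hGl).comp (contDiff_const_smul _), fun η hη => ?_,
    hgrad h.memLp_x h.weak_x, hgrad h.memLp_y h.weak_y⟩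
  obtain ⟨δ, hδ, huc⟩ := Metric.uniformContinuousOn_iff.1
    (isCompact_closure_Omega.uniformContinuousOn_of_continuous hc) (η / 2) (by positivity)
  filter_upwards [hrt.eventually (gt_mem_nhds (show 0 < δ / 4 by linarith))] with n hn z hz
  have hz1 : ‖z‖ ≤ 1 := by
    rw [closure_Omega_eq] at hz; exact mem_closedBall_zero_iff.1 hz
  have htz : t n • z ∈ Omega :=
    hball n z hz1 (Metric.mem_closedBall_self (hr0 n).le)
  have h1 : |mollify (ρ n) (Omega.indicator G) (t n • z) - Omega.indicator G (t n • z)| ≤ η / 2 := by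
    refine (ρ n).dist_normed_convolution_le hG.1 fun x hx => ?_
    have hxO := hball n z hz1 (Metric.ball_subset_closedBall hx)
    rw [Set.indicator_of_mem hxO, Set.indicator_of_mem htz]
    refine (huc _ (subset_closure hxO) _ (subset_closure htz) ?_).le
    have : dist x (t n • z) < r n := hx
    linarith
  have h2 : |G (t n • z) - G z| ≤ η / 2 := by
    refine (huc _ (subset_closure htz) _ hz ?_).le
    have h3 := dist_smul_self_le (ht1 n) hz1
    have : t n = 1 - 2 * r n := rfl
    linarith
  rw [Set.indicator_of_mem htz] at h1
  exact (abs_sub_le _ _ _).trans (by linarith)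

/-! ### Truncation and the weak maximum principle -/

theorem integral_sq_eq {f : ℝ × ℝ → ℝ} (hf : MemLp f 2 area) :
    ∫ z, f z ^ 2 ∂area = (eLpNorm f 2 area).toReal ^ 2 := by
  rw [hf.eLpNorm_eq_integral_rpow_norm (by norm_num) (by norm_num),
    ENNReal.toReal_ofReal (by positivity), ← Real.rpow_natCast, ← Real.rpow_mul]
  · simp
  · positivity

theorem tendsto_integral_sq {f : ℕ → ℝ × ℝ → ℝ} (hf : ∀ n, MemLp (f n) 2 area)
    (h : Tendsto (fun n => eLpNorm (f n) 2 area) atTop (𝓝 0)) :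
    Tendsto (fun n => ∫ z, f n z ^ 2 ∂area) atTop (𝓝 0) := by
  simp only [fun n => integral_sq_eq (hf n)]
  have := (ENNReal.tendsto_toReal ENNReal.zero_ne_top).comp h
  simpa using this.pow 2

/-- A smooth cut-off profile: it vanishes on `(-∞, c]`, is positive on `(c, ∞)`, and is bounded and
nondecreasing with bounded derivative. -/
theorem exists_smooth_profile (c : ℝ) : ∃ (γ : ℝ → ℝ) (M : ℝ), ContDiff ℝ ∞ γ ∧
    (∀ t ≤ c, γ t = 0) ∧ (∀ t, c < t → 0 < γ t) ∧ (∀ t, 0 ≤ γ t) ∧ (∀ t, γ t ≤ 1) ∧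
    (∀ t, 0 ≤ deriv γ t) ∧ ∀ t, deriv γ t ≤ M := by
  have hsm : ContDiff ℝ ∞ Real.smoothTransition := Real.smoothTransition.contDiff
  have hcont : Continuous (deriv Real.smoothTransition) := hsm.continuous_deriv (by simp)
  obtain ⟨M, hM⟩ := (isCompact_Icc (a := (0 : ℝ)) (b := 1)).exists_bound_of_continuousOn
    hcont.continuousOn
  have hd : ∀ t, deriv (fun t => Real.smoothTransition (t - c)) t =
      deriv Real.smoothTransition (t - c) := fun t => deriv_comp_sub_const ..
  refine ⟨fun t => Real.smoothTransition (t - c), M, hsm.comp (contDiff_id.sub contDiff_const),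
    fun t ht => Real.smoothTransition.zero_of_nonpos (by linarith),
    fun t ht => Real.smoothTransition.pos_of_pos (by linarith),
    fun t => Real.smoothTransition.nonneg _, fun t => Real.smoothTransition.le_one _,
    fun t => by rw [hd]; exact Real.smoothTransition.monotone.deriv_nonneg, fun t => ?_⟩
  rw [hd]
  have hM0 : 0 ≤ M := (norm_nonneg _).trans (hM 0 (by simp))
  rcases lt_or_ge (t - c) 0 with h0 | h0
  · have : Real.smoothTransition =ᶠ[𝓝 (t - c)] fun _ => 0 := by
      filter_upwards [gt_mem_nhds h0] with s hs using Real.smoothTransition.zero_of_nonpos hs.le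
    rw [this.deriv_eq]; simpa using hM0
  rcases lt_or_ge 1 (t - c) with h1 | h1
  · have : Real.smoothTransition =ᶠ[𝓝 (t - c)] fun _ => 1 := by
      filter_upwards [lt_mem_nhds h1] with s hs using Real.smoothTransition.one_of_one_le hs.le
    rw [this.deriv_eq]; simpa using hM0
  · exact (le_abs_self _).trans (hM _ ⟨h0, h1⟩)

theorem fderiv_comp_profile {γ : ℝ → ℝ} (hγ : ContDiff ℝ ∞ γ) {w : ℝ × ℝ → ℝ}
    (hw : ContDiff ℝ ∞ w) (z v : ℝ × ℝ) :
    fderiv ℝ (fun z => γ (w z)) z v = deriv γ (w z) * fderiv ℝ w z v := by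
  have h := ((hγ.differentiable (by simp) (w z)).hasDerivAt).comp_hasFDerivAt z
    (hw.differentiable (by simp) z).hasFDerivAt
  change HasFDerivAt (fun z => γ (w z)) _ z at h
  rw [h.fderiv]; simp

/-- Truncating a smooth function that is small near the boundary yields a test function. -/
theorem isTest_indicator_comp {γ : ℝ → ℝ} (hγ : ContDiff ℝ ∞ γ) {c : ℝ} (hγ0 : ∀ t ≤ c, γ t = 0)
    {w : ℝ × ℝ → ℝ} (hw : ContDiff ℝ ∞ w) {S : Set (ℝ × ℝ)} (hS : IsCompact S) (hSO : S ⊆ Omega)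
    (hwS : ∀ z ∈ Omega, z ∉ S → w z ≤ c) : IsTest (Omega.indicator fun z => γ (w z)) := by
  have h0 : ∀ z ∉ S, Omega.indicator (fun z => γ (w z)) z = 0 := fun z hz => by
    by_cases hzO : z ∈ Omega
    · rw [Set.indicator_of_mem hzO, hγ0 _ (hwS z hzO hz)]
    · exact Set.indicator_of_notMem hzO _
  have hts : tsupport (Omega.indicator fun z => γ (w z)) ⊆ S :=
    closure_minimal (fun z hz => by by_contra hh; exact hz (h0 z hh)) hS.isClosed
  refine ⟨contDiff_iff_contDiffAt.2 fun z => ?_,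
    HasCompactSupport.of_support_subset_isCompact hS ((subset_tsupport _).trans hts),
    hts.trans hSO⟩
  -- Smoothness is local: near a point of the square the function is `γ ∘ w`, and near any other
  -- point it vanishes, as `S` is closed.
  by_cases hzO : z ∈ Omega
  · refine (hγ.comp hw).contDiffAt.congr_of_eventuallyEq ?_
    filter_upwards [isOpen_Omega.mem_nhds hzO] with y hy using Set.indicator_of_mem hy _
  · have hz : z ∈ Sᶜ := fun hh => hzO (hSO hh)
    refine (contDiffAt_const (c := (0 : ℝ))).congr_of_eventuallyEq ?_
    filter_upwards [hS.isClosed.isOpen_compl.mem_nhds hz] with y hy using h0 y hy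

theorem fderiv_indicator_comp {γ : ℝ → ℝ} (hγ : ContDiff ℝ ∞ γ) {w : ℝ × ℝ → ℝ}
    (hw : ContDiff ℝ ∞ w) {z : ℝ × ℝ} (hz : z ∈ Omega) (v : ℝ × ℝ) :
    fderiv ℝ (Omega.indicator fun z => γ (w z)) z v = deriv γ (w z) * fderiv ℝ w z v := by
  have : Omega.indicator (fun z => γ (w z)) =ᶠ[𝓝 z] fun z => γ (w z) := by
    filter_upwards [isOpen_Omega.mem_nhds hz] with y hy using Set.indicator_of_mem hy _
  rw [this.fderiv_eq, fderiv_comp_profile hγ hw]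

/-- The energy estimate behind the weak maximum principle. -/
theorem integral_sq_profile_le {β : ℝ} (hβ : 0 ≤ β) {u ux uy f : ℝ × ℝ → ℝ}
    (hu : HasH1Grad u ux uy) (hs : ∀ φ, IsTest φ →
      ∫ z, (β * ux z * dx φ z + uy z * dy φ z) ∂area = - ∫ z, f z * φ z ∂area)
    {γ : ℝ → ℝ} (hγ : ContDiff ℝ ∞ γ) {c M : ℝ} (hγ0 : ∀ t ≤ c, γ t = 0)
    (hγ1 : ∀ t, 0 ≤ deriv γ t) (hγM : ∀ t, deriv γ t ≤ M)
    {w : ℝ × ℝ → ℝ} (hw : ContDiff ℝ ∞ w) {S : Set (ℝ × ℝ)} (hS : IsCompact S) (hSO : S ⊆ Omega)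
    (hwS : ∀ z ∈ Omega, z ∉ S → w z ≤ c) :
    ∫ z, γ (w z) ^ 2 ∂area ≤ 4 * M * (-2 * ∫ z, f z * γ (w z) ∂area +
      M * (β * ∫ z, (dx w z - ux z) ^ 2 ∂area + ∫ z, (dy w z - uy z) ^ 2 ∂area)) := by
  set ψ := Omega.indicator fun z => γ (w z) with hψ
  have hT : IsTest ψ := isTest_indicator_comp hγ hγ0 hw hS hSO hwS
  have hM : 0 ≤ M := (hγ1 0).trans (hγM 0)
  have hcw : ∀ v, Continuous fun z => fderiv ℝ w z v := fun v =>
    (hw.continuous_fderiv (by simp)).clm_apply continuous_const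
  have hwx : Continuous (dx w) := hcw _
  have hwy : Continuous (dy w) := hcw _
  have hψe : ∀ z ∈ Omega, ψ z = γ (w z) := fun z hz => Set.indicator_of_mem hz _
  have hψx : ∀ z ∈ Omega, dx ψ z = deriv γ (w z) * dx w z := fun z hz =>
    fderiv_indicator_comp hγ hw hz _
  have hψy : ∀ z ∈ Omega, dy ψ z = deriv γ (w z) * dy w z := fun z hz =>
    fderiv_indicator_comp hγ hw hz _
  have i1 : Integrable (fun z => β * ux z * dx ψ z + uy z * dy ψ z) area :=
    ((hu.memLp_x.const_mul β).integrable_mul (hT.dx_memLp 2)).add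
      (hu.memLp_y.integrable_mul (hT.dy_memLp 2))
  have i2 : Integrable (fun z => (dx w z - ux z) ^ 2) area :=
    ((memLp_of_continuousOn hwx.continuousOn 2).sub hu.memLp_x).integrable_sq
  have i3 : Integrable (fun z => (dy w z - uy z) ^ 2) area :=
    ((memLp_of_continuousOn hwy.continuousOn 2).sub hu.memLp_y).integrable_sq
  have i4 : Integrable (fun z => β * (dx w z - ux z) ^ 2 + (dy w z - uy z) ^ 2) area :=
    (i2.const_mul β).add i3
  -- The energy of the truncation is bounded by the tested weak equation, which involves `∇u`, plus
  -- an error in `∇w - ∇u`.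
  have h1 : ∫ z, dy ψ z ^ 2 ∂area ≤ ∫ z, M * (2 * (β * ux z * dx ψ z + uy z * dy ψ z) +
      M * (β * (dx w z - ux z) ^ 2 + (dy w z - uy z) ^ 2)) ∂area := by
    refine integral_mono_ae (hT.dy_memLp 2).integrable_sq
      (((i1.const_mul 2).add (i4.const_mul M)).const_mul M) ?_
    filter_upwards [ae_mem_Omega] with z hz
    rw [hψx z hz, hψy z hz]
    have g0 := hγ1 (w z)
    have g1 := hγM (w z)
    generalize deriv γ (w z) = g at g0 g1
    generalize dx w z = a
    generalize dy w z = d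
    generalize ux z = p
    generalize uy z = q
    -- From `2apg = g a² + g p² - g (a - p)²` and `0 ≤ g ≤ M`.
    have key : ∀ a p : ℝ, g * a ^ 2 ≤ 2 * (p * (g * a)) + M * (a - p) ^ 2 := fun a p => by
      nlinarith [mul_nonneg g0 (sq_nonneg p), mul_nonneg (sub_nonneg.2 g1) (sq_nonneg (a - p))]
    have k1 : 0 ≤ β * (2 * (p * (g * a)) + M * (a - p) ^ 2) :=
      mul_nonneg hβ ((mul_nonneg g0 (sq_nonneg a)).trans (key a p))
    have k2 : (g * d) ^ 2 ≤ M * (g * d ^ 2) := by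
      nlinarith [mul_nonneg (mul_nonneg g0 (sub_nonneg.2 g1)) (sq_nonneg d)]
    calc (g * d) ^ 2 ≤ M * (g * d ^ 2) := k2
      _ ≤ M * (2 * (β * p * (g * a) + q * (g * d)) + M * (β * (a - p) ^ 2 + (d - q) ^ 2)) :=
        mul_le_mul_of_nonneg_left (by nlinarith [key d q]) hM
  have h2 : ∫ z, f z * ψ z ∂area = ∫ z, f z * γ (w z) ∂area := by
    refine integral_congr_ae ?_
    filter_upwards [ae_mem_Omega] with z hz
    rw [hψe z hz]
  have h3 : ∫ z, ψ z ^ 2 ∂area = ∫ z, γ (w z) ^ 2 ∂area := by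
    refine integral_congr_ae ?_
    filter_upwards [ae_mem_Omega] with z hz
    rw [hψe z hz]
  rw [integral_const_mul, integral_add (i1.const_mul 2) (i4.const_mul M),
    integral_const_mul, integral_const_mul, integral_add (i2.const_mul β) i3, integral_const_mul,
    hs ψ hT, h2] at h1
  have h4 := hT.poincare
  rw [h3] at h4
  linarith

/-- Smooth approximations of a function in `H¹₀(Ω) + H¹(Ω) ∩ C(closure Ω)` whose boundary values
are at most `K`. -/
theorem exists_smooth_approx {u ux uy G : ℝ × ℝ → ℝ} {K : ℝ} (hu : HasH1Grad u ux uy)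
    (hG : MemH1 G) (hGc : ContinuousOn G (closure Omega)) (hGK : ∀ z ∈ frontier Omega, G z ≤ K)
    (h0 : MemH10 fun z => u z - G z) : ∃ w : ℕ → ℝ × ℝ → ℝ, (∀ n, ContDiff ℝ ∞ (w n)) ∧
      Tendsto (fun n => ∫ z, (dx (w n) z - ux z) ^ 2 ∂area) atTop (𝓝 0) ∧
      Tendsto (fun n => ∫ z, (dy (w n) z - uy z) ^ 2 ∂area) atTop (𝓝 0) ∧
      (∀ᵐ z ∂area, Tendsto (fun n => w n z) atTop (𝓝 (u z))) ∧
      ∀ c > K, ∀ᶠ n in atTop, ∃ S, IsCompact S ∧ S ⊆ Omega ∧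
        ∀ z ∈ Omega, z ∉ S → w n z ≤ c := by
  obtain ⟨gx, gy, hG⟩ := hG
  obtain ⟨vx, vy, hv, φ, hφ, k0, k1, k2⟩ := h0
  obtain ⟨g, hg, l0, l1, l2⟩ := hG.exists_contDiff_tendsto hGc
  obtain ⟨ns, hns, hae⟩ := exists_subseq_tendsto_ae (by norm_num) (fun n => (hφ n).memLp 2)
    hv.memLp k0
  have hns' := hns.tendsto_atTop
  have hdg : ∀ n v, MemLp (fun z => fderiv ℝ (g n) z v) 2 area := fun n v => memLp_of_continuousOn
    (((hg n).continuous_fderiv (by simp)).clm_apply continuous_const).continuousOn 2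
  have hd : ∀ n z v, fderiv ℝ (fun z => φ n z + g n z) z v =
      fderiv ℝ (φ n) z v + fderiv ℝ (g n) z v := fun n z v => by
    rw [_root_.fderiv_fun_add ((hφ n).contDiff_one.differentiable (by simp) z)
      ((hg n).differentiable (by simp) z)]; rfl
  -- The given gradient of `u` is a.e. the sum of those of `u - G` and `G`.
  obtain ⟨ex, ey⟩ := hu.ae_eq (by
    have := hv.linear hG 1 1
    simpa using this : HasH1Grad u (fun z => vx z + gx z) (fun z => vy z + gy z))
  have hcw : ∀ n v, Continuous fun z => fderiv ℝ (fun z => φ n z + g n z) z v := fun n v =>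
    (((hφ n).smooth.add (hg n)).continuous_fderiv (by simp)).clm_apply continuous_const
  have hgrad : ∀ {v : ℝ × ℝ} {a d e : ℝ × ℝ → ℝ}, MemLp a 2 area → MemLp d 2 area →
      e =ᵐ[area] (fun z => a z + d z) →
      Tendsto (fun n => eLpNorm (fun z => fderiv ℝ (φ n) z v - a z) 2 area) atTop (𝓝 0) →
      Tendsto (fun n => eLpNorm (fun z => fderiv ℝ (g n) z v - d z) 2 area) atTop (𝓝 0) →
      Tendsto (fun n => ∫ z, (fderiv ℝ (fun z => φ (ns n) z + g (ns n) z) z v - e z) ^ 2 ∂area)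
        atTop (𝓝 0) := by
    intro v a d e ha hd' he t1 t2
    have h := (tendsto_eLpNorm_linear (by norm_num) (fun n => (hφ n).fderiv_memLp v 2)
      (fun n => hdg n v) ha hd' t1 t2 1 1).comp hns'
    have h' := tendsto_integral_sq (fun n => (MemLp.linear ((hφ (ns n)).fderiv_memLp v 2)
      (hdg (ns n) v) 1 1).sub (MemLp.linear ha hd' 1 1)) h
    refine h'.congr fun n => integral_congr_ae ?_
    filter_upwards [he] with z hz
    simp [hz, hd]
  refine ⟨fun n z => φ (ns n) z + g (ns n) z, fun n => (hφ _).smooth.add (hg _),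
    hgrad hv.memLp_x hG.memLp_x ex k1 l1, hgrad hv.memLp_y hG.memLp_y ey k2 l2, ?_, ?_⟩
  · filter_upwards [hae, ae_mem_Omega] with z hz hzO
    have : Tendsto (fun n => g (ns n) z) atTop (𝓝 (G z)) := by
      rw [Metric.tendsto_nhds]
      intro η hη
      filter_upwards [hns'.eventually (l0 (η / 2) (half_pos hη))] with n hn
      rw [Real.dist_eq]
      linarith [hn z (subset_closure hzO)]
    simpa using hz.add this
  · intro c hc
    filter_upwards [hns'.eventually (l0 ((c - K) / 2) (by linarith))] with n hn
    -- Off the support of `φ` only `g` remains. The superlevel set `{g ≥ c}` misses the boundary,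
    -- where `g ≤ K + (c - K) / 2 < c`.
    refine ⟨tsupport (φ (ns n)) ∪ (closure Omega ∩ g (ns n) ⁻¹' Set.Ici c),
      (hφ _).compact.isCompact.union (isCompact_closure_Omega.inter_right
        (isClosed_Ici.preimage (hg _).continuous)), ?_, ?_⟩
    · rintro z (hz | ⟨hz, hz'⟩)
      · exact (hφ _).support hz
      · by_contra hzO
        have hfr : z ∈ frontier Omega := by
          rw [frontier, isOpen_Omega.interior_eq]; exact ⟨hz, hzO⟩
        have h1 := (abs_le.1 (hn z hz)).2
        have h2 := hGK z hfr
        have h3 : c ≤ g (ns n) z := hz'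
        linarith
    · intro z hz hzS
      rw [Set.mem_union, not_or] at hzS
      rw [image_eq_zero_of_notMem_tsupport hzS.1, zero_add]
      by_contra! hh
      exact hzS.2 ⟨subset_closure hz, hh.le⟩

/-- **Weak maximum principle.** -/
theorem SolvesWeakly.ae_le {b : ℝ} {u f G : ℝ × ℝ → ℝ} {K : ℝ} (hu : SolvesWeakly b u f)
    (hf : Integrable f area) (hG : MemH1 G) (hGc : ContinuousOn G (closure Omega))
    (hGK : ∀ z ∈ frontier Omega, G z ≤ K) (h0 : MemH10 fun z => u z - G z)
    (hpos : ∀ᵐ z ∂area, K < u z → 0 ≤ f z) : ∀ᵐ z ∂area, u z ≤ K := by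
  obtain ⟨ux, uy, hu, hs⟩ := hu
  obtain ⟨w, hw, h1, h2, h3, h4⟩ := exists_smooth_approx hu hG hGc hGK h0
  -- Truncating strictly above `K` leaves room for the uniform approximation error at the boundary.
  have main : ∀ c > K, ∀ᵐ z ∂area, u z ≤ c := by
    intro c hc
    obtain ⟨γ, M, hγ, hγ0, hγp, hγn, hγ1, hd0, hdM⟩ := exists_smooth_profile c
    have hM : 0 ≤ M := (hd0 0).trans (hdM 0)
    have hcont : Continuous γ := hγ.continuous
    have hγm : AEStronglyMeasurable (fun z => γ (u z)) area :=
      hcont.comp_aestronglyMeasurable hu.memLp.1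
    have hγwm : ∀ n, AEStronglyMeasurable (fun z => γ (w n z)) area := fun n =>
      (hcont.comp (hw n).continuous).aestronglyMeasurable
    have hb : ∀ t, ‖γ t‖ ≤ 1 := fun t => by
      rw [Real.norm_of_nonneg (hγn t)]; exact hγ1 t
    have t1 : Tendsto (fun n => ∫ z, γ (w n z) ^ 2 ∂area) atTop (𝓝 (∫ z, γ (u z) ^ 2 ∂area)) := by
      refine tendsto_integral_of_dominated_convergence (fun _ => 1) (fun n => (hγwm n).pow 2)
        (integrable_const _) (fun n => ae_of_all _ fun z => ?_) ?_
      · rw [norm_pow]; exact pow_le_one₀ (norm_nonneg _) (hb _)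
      · filter_upwards [h3] with z hz using ((hcont.tendsto _).comp hz).pow 2
    have t2 : Tendsto (fun n => ∫ z, f z * γ (w n z) ∂area) atTop
        (𝓝 (∫ z, f z * γ (u z) ∂area)) := by
      refine tendsto_integral_of_dominated_convergence (fun z => ‖f z‖)
        (fun n => hf.1.mul (hγwm n)) hf.norm (fun n => ae_of_all _ fun z => ?_) ?_
      · rw [norm_mul]; exact mul_le_of_le_one_right (norm_nonneg _) (hb _)
      · filter_upwards [h3] with z hz using ((hcont.tendsto _).comp hz).const_mul _
    have t3 := ((t2.const_mul (-2)).add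
      (((h1.const_mul (1 / b ^ 2)).add h2).const_mul M)).const_mul (4 * M)
    -- In the limit the gradient error disappears and only the term with `f` survives.
    have hle : ∫ z, γ (u z) ^ 2 ∂area ≤ 4 * M * (-2 * ∫ z, f z * γ (u z) ∂area +
        M * (1 / b ^ 2 * 0 + 0)) := by
      refine le_of_tendsto_of_tendsto t1 t3 ?_
      filter_upwards [h4 c hc] with n hn
      obtain ⟨S, hS, hSO, hwS⟩ := hn
      exact integral_sq_profile_le (by positivity) hu hs hγ hγ0 hd0 hdM (hw n) hS hSO hwS
    -- Where `γ(u)` is nonzero, `u > c > K`, so `f ≥ 0` there.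
    have hfn : 0 ≤ ∫ z, f z * γ (u z) ∂area := by
      refine integral_nonneg_of_ae ?_
      filter_upwards [hpos] with z hz
      rcases le_or_gt (u z) c with h | h
      · simp [hγ0 _ h]
      · exact mul_nonneg (hz (hc.trans h)) (hγn _)
    have hzero : ∫ z, γ (u z) ^ 2 ∂area = 0 := by
      refine le_antisymm (hle.trans ?_) (integral_nonneg fun z => sq_nonneg _)
      nlinarith [mul_nonneg hM hfn]
    have hint : Integrable (fun z => γ (u z) ^ 2) area :=
      Integrable.of_bound (hγm.pow 2) 1 (ae_of_all _ fun z => by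
        rw [norm_pow]; exact pow_le_one₀ (norm_nonneg _) (hb _))
    rw [integral_eq_zero_iff_of_nonneg (fun z => sq_nonneg _) hint] at hzero
    filter_upwards [hzero] with z hz
    by_contra! hh
    exact (pow_pos (hγp _ hh) 2).ne' hz
  have hall := ae_all_iff.2 fun n : ℕ => main (K + 1 / ((n : ℝ) + 1)) (by
    have : 0 < 1 / ((n : ℝ) + 1) := by positivity
    linarith)
  filter_upwards [hall] with z hz
  refine ge_of_tendsto' (x := atTop) (f := fun n : ℕ => K + 1 / ((n : ℝ) + 1)) ?_ hz
  simpa only [add_zero] using (tendsto_one_div_add_atTop_nhds_zero_nat (𝕜 := ℝ)).const_add K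

/-! ### Existence for the Dirichlet problem -/

/-- Lipschitz functions on the plane are in `H¹(Ω)`. -/
theorem MemH1.of_lipschitz {c : NNReal} {g : ℝ × ℝ → ℝ} (hg : LipschitzWith c g) : MemH1 g := by
  -- Directional derivatives of a Lipschitz function are bounded, hence square integrable on the
  -- square.
  have hd : ∀ v, MemLp (fun z => lineDeriv ℝ g z v) 2 area := fun v =>
    (hg.memLp_lineDeriv (μ := area) v).mono_exponent le_top
  have hw : ∀ v φ, IsTest φ →
      ∫ z, g z * fderiv ℝ φ z v ∂area = - ∫ z, lineDeriv ℝ g z v * φ z ∂area := by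
    intro v φ h
    rw [integral_area_eq fun z hz => by simp [h.fderiv_eq_zero hz],
      integral_area_eq fun z hz => by simp [h.eq_zero hz]]
    obtain ⟨D, hD⟩ := h.contDiff_one.lipschitzWith_of_hasCompactSupport h.compact (by simp)
    rw [hg.integral_lineDeriv_mul_eq hD h.compact v, ← integral_neg]
    congr 1; ext z
    rw [(h.contDiff_one.differentiable (by simp) z).lineDeriv_eq_fderiv, map_neg]; ring
  exact ⟨_, _, memLp_of_continuousOn hg.continuous.continuousOn 2, hd (1, 0), hd (0, 1),
    hw (1, 0), hw (0, 1)⟩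

theorem tendsto_integral_mul {f : ℕ → ℝ × ℝ → ℝ} {F h : ℝ × ℝ → ℝ}
    (hf : ∀ n, MemLp (f n) 2 area) (hF : MemLp F 2 area) (hh : MemLp h 2 area)
    (ht : Tendsto (fun n => eLpNorm (fun z => f n z - F z) 2 area) atTop (𝓝 0)) :
    Tendsto (fun n => ∫ z, f n z * h z ∂area) atTop (𝓝 (∫ z, F z * h z ∂area)) := by
  refine tendsto_integral_of_L1' _ (hF.1.mul hh.1)
    (Eventually.of_forall fun n => (hf n).integrable_mul hh) ?_
  have hle : ∀ n, eLpNorm ((fun z => f n z * h z) - fun z => F z * h z) 1 area ≤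
      eLpNorm (fun z => f n z - F z) 2 area * eLpNorm h 2 area := fun n => by
    have e : ((fun z => f n z * h z) - fun z => F z * h z) = (fun z => f n z - F z) • h := by
      ext z; simp; ring
    rw [e]
    exact eLpNorm_smul_le_mul_eLpNorm hh.1 ((hf n).sub hF).1
  refine tendsto_of_tendsto_of_tendsto_of_le_of_le tendsto_const_nhds ?_ (fun _ => zero_le) hle
  simpa using ENNReal.Tendsto.mul_const ht (Or.inr hh.2.ne)

/-- Weak differentiation is closed: integration by parts for the `φ n` against a fixed test function
passes to the limit. -/
theorem MemH10.of_tendsto {φ : ℕ → ℝ × ℝ → ℝ} {v vx vy : ℝ × ℝ → ℝ} (hφ : ∀ n, IsTest (φ n))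
    (hv : MemLp v 2 area) (hx : MemLp vx 2 area) (hy : MemLp vy 2 area)
    (h0 : Tendsto (fun n => eLpNorm (fun z => φ n z - v z) 2 area) atTop (𝓝 0))
    (h1 : Tendsto (fun n => eLpNorm (fun z => dx (φ n) z - vx z) 2 area) atTop (𝓝 0))
    (h2 : Tendsto (fun n => eLpNorm (fun z => dy (φ n) z - vy z) 2 area) atTop (𝓝 0)) :
    HasH1Grad v vx vy ∧ MemH10 v := by
  suffices h : HasH1Grad v vx vy from ⟨h, vx, vy, h, φ, hφ, h0, h1, h2⟩
  have hw : ∀ {w : ℝ × ℝ} {d : ℝ × ℝ → ℝ}, MemLp d 2 area →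
      Tendsto (fun n => eLpNorm (fun z => fderiv ℝ (φ n) z w - d z) 2 area) atTop (𝓝 0) →
      ∀ ψ, IsTest ψ → ∫ z, v z * fderiv ℝ ψ z w ∂area = - ∫ z, d z * ψ z ∂area := by
    intro w d hd ht ψ hψ
    refine tendsto_nhds_unique
      (tendsto_integral_mul (fun n => (hφ n).memLp 2) hv (hψ.fderiv_memLp w 2) h0) ?_
    refine ((tendsto_integral_mul (fun n => (hφ n).fderiv_memLp w 2) hd (hψ.memLp 2) ht).neg).congr
      fun n => ?_
    exact (hψ.integral_mul_fderiv (hφ n).contDiff_one w).symm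
  exact ⟨hv, hx, hy, hw hx h1, hw hy h2⟩

/-- Weighted `L²` gradients on the square. -/
abbrev GradSpace : Type := WithLp 2 (Lp ℝ 2 area × Lp ℝ 2 area)

/-- The weighted gradients of test functions. -/
noncomputable def testGradients (a : ℝ) : Submodule ℝ GradSpace where
  carrier := {x | ∃ φ, IsTest φ ∧ x.fst =ᵐ[area] (fun z => a * dx φ z) ∧ x.snd =ᵐ[area] dy φ}
  add_mem' := by
    rintro x y ⟨φ, hφ, h1, h2⟩ ⟨ψ, hψ, k1, k2⟩
    refine ⟨fun z => φ z + ψ z, hφ.add hψ, ?_, ?_⟩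
    · rw [WithLp.add_fst]
      filter_upwards [Lp.coeFn_add x.fst y.fst, h1, k1] with z e1 e2 e3
      rw [e1, Pi.add_apply, e2, e3]; simp only [dx, hφ.fderiv_add hψ]; ring
    · rw [WithLp.add_snd]
      filter_upwards [Lp.coeFn_add x.snd y.snd, h2, k2] with z e1 e2 e3
      rw [e1, Pi.add_apply, e2, e3]; simp only [dy, hφ.fderiv_add hψ]
  zero_mem' := by
    refine ⟨fun _ => 0, IsTest.zero, ?_, ?_⟩
    · filter_upwards [Lp.coeFn_zero ℝ 2 area] with z e1
      rw [WithLp.zero_fst, e1]; simp [dx]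
    · filter_upwards [Lp.coeFn_zero ℝ 2 area] with z e1
      rw [WithLp.zero_snd, e1]; simp [dy]
  smul_mem' := by
    rintro c x ⟨φ, hφ, h1, h2⟩
    refine ⟨fun z => c * φ z, hφ.const_mul c, ?_, ?_⟩
    · rw [WithLp.smul_fst]
      filter_upwards [Lp.coeFn_smul c x.fst, h1] with z e1 e2
      rw [e1, Pi.smul_apply, e2]; simp only [dx, hφ.fderiv_const_mul, smul_eq_mul]; ring
    · rw [WithLp.smul_snd]
      filter_upwards [Lp.coeFn_smul c x.snd, h2] with z e1 e2
      rw [e1, Pi.smul_apply, e2]; simp only [dy, hφ.fderiv_const_mul, smul_eq_mul]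

/-- Poincaré in norm form, so that convergence of gradients forces convergence of the functions. -/
theorem IsTest.eLpNorm_le_two_mul {φ : ℝ × ℝ → ℝ} (h : IsTest φ) :
    eLpNorm φ 2 area ≤ 2 * eLpNorm (dy φ) 2 area := by
  have h1 := h.poincare
  rw [integral_sq_eq (h.memLp 2), integral_sq_eq (h.dy_memLp 2)] at h1
  rw [← ENNReal.toReal_le_toReal (h.memLp 2).2.ne
    (ENNReal.mul_ne_top (by simp) (h.dy_memLp 2).2.ne), ENNReal.toReal_mul]
  refine (sq_le_sq₀ (by positivity) (by positivity)).1 ?_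
  rw [mul_pow]; norm_num; linarith

/-- An element of the closure of the weighted test gradients is the weighted gradient of an
element of `H¹₀(Ω)`. -/
theorem exists_memH10_of_mem_closure {a : ℝ} (ha : a ≠ 0) {p : GradSpace}
    (hp : p ∈ (testGradients a).topologicalClosure) :
    ∃ v vx : ℝ × ℝ → ℝ, HasH1Grad v vx p.snd ∧ MemH10 v ∧ p.fst =ᵐ[area] fun z => a * vx z := by
  obtain ⟨x, hx, hlim⟩ := mem_closure_iff_seq_limit.1 hp
  choose φ hφ h1 h2 using hx
  have l1 : Tendsto (fun n => eLpNorm (fun z => a * dx (φ n) z - p.fst z) 2 area) atTop (𝓝 0) := by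
    have := (((WithLp.continuous_fst 2 _ _).tendsto p).comp hlim)
    rw [Lp.tendsto_Lp_iff_tendsto_eLpNorm'] at this
    refine this.congr fun n => eLpNorm_congr_ae ?_
    filter_upwards [h1 n] with z hz
    simp [hz]
  have l2 : Tendsto (fun n => eLpNorm (fun z => dy (φ n) z - p.snd z) 2 area) atTop (𝓝 0) := by
    have := (((WithLp.continuous_snd 2 _ _).tendsto p).comp hlim)
    rw [Lp.tendsto_Lp_iff_tendsto_eLpNorm'] at this
    refine this.congr fun n => eLpNorm_congr_ae ?_
    filter_upwards [h2 n] with z hz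
    simp [hz]
  -- Poincaré for `φ m - φ n` transfers the Cauchy property from the `y` derivatives.
  have hcau : CauchySeq fun n => ((hφ n).memLp 2).toLp (φ n) := by
    rw [Metric.cauchySeq_iff]
    intro η hη
    obtain ⟨N, hN⟩ := Metric.cauchySeq_iff.1 hlim.cauchySeq (η / 2) (half_pos hη)
    refine ⟨N, fun m hm n hn => ?_⟩
    have hT : IsTest fun z => φ m z + (-1) * φ n z := (hφ m).add ((hφ n).const_mul (-1))
    have h3 : eLpNorm (fun z => φ m z + (-1) * φ n z) 2 area ≤
        2 * eLpNorm (⇑(x m).snd - ⇑(x n).snd) 2 area := by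
      refine hT.eLpNorm_le_two_mul.trans (le_of_eq ?_)
      congr 1
      refine eLpNorm_congr_ae ?_
      filter_upwards [h2 m, h2 n] with z e1 e2
      rw [dy, IsTest.fderiv_add (hφ m) ((hφ n).const_mul (-1)), (hφ n).fderiv_const_mul,
        Pi.sub_apply, e1, e2, dy, dy]; ring
    have h4 : dist (((hφ m).memLp 2).toLp (φ m)) (((hφ n).memLp 2).toLp (φ n)) ≤
        2 * dist (x m).snd (x n).snd := by
      rw [Lp.dist_def, Lp.dist_def]
      have e : eLpNorm (⇑(((hφ m).memLp 2).toLp (φ m)) - ⇑(((hφ n).memLp 2).toLp (φ n))) 2 area =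
          eLpNorm (fun z => φ m z + (-1) * φ n z) 2 area := by
        refine eLpNorm_congr_ae ?_
        filter_upwards [((hφ m).memLp 2).coeFn_toLp, ((hφ n).memLp 2).coeFn_toLp] with z e1 e2
        rw [Pi.sub_apply, e1, e2]; ring
      rw [e]
      have h5 := ENNReal.toReal_mono (ENNReal.mul_ne_top (by simp)
        ((Lp.memLp (x m).snd).sub (Lp.memLp (x n).snd)).2.ne) h3
      rwa [ENNReal.toReal_mul] at h5
    have h6 := hN m hm n hn
    have h7 : dist (x m).snd (x n).snd ≤ dist (x m) (x n) := WithLp.dist_snd_le _ _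
    linarith
  obtain ⟨v, hv⟩ := cauchySeq_tendsto_of_complete hcau
  rw [Lp.tendsto_Lp_iff_tendsto_eLpNorm'] at hv
  have l0 : Tendsto (fun n => eLpNorm (fun z => φ n z - v z) 2 area) atTop (𝓝 0) := by
    refine hv.congr fun n => eLpNorm_congr_ae ?_
    filter_upwards [((hφ n).memLp 2).coeFn_toLp] with z e1
    rw [Pi.sub_apply, e1]
  have l1' : Tendsto (fun n => eLpNorm (fun z => dx (φ n) z - a⁻¹ * p.fst z) 2 area)
      atTop (𝓝 0) := by
    have := ENNReal.Tendsto.const_mul l1 (a := ‖a⁻¹‖ₑ) (Or.inr enorm_ne_top)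
    rw [mul_zero] at this
    refine this.congr fun n => ?_
    rw [← eLpNorm_const_smul]
    congr 1; ext z
    simp [mul_sub, ha]
  obtain ⟨k1, k2⟩ := MemH10.of_tendsto hφ (Lp.memLp v) ((Lp.memLp p.fst).const_mul a⁻¹)
    (Lp.memLp p.snd) l0 l1' l2
  exact ⟨v, _, k1, k2, ae_of_all _ fun z => by simp [ha]⟩

/-- The Dirichlet problem for `b⁻² ∂ₓₓ + ∂_yy` with boundary values given by `G ∈ H¹(Ω)`. -/
theorem exists_solvesWeakly {b : ℝ} (hb : b ≠ 0) {G : ℝ × ℝ → ℝ} (hG : MemH1 G) :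
    ∃ u, MemH1 u ∧ SolvesWeakly b u (fun _ => 0) ∧ MemH10 fun z => u z - G z := by
  obtain ⟨gx, gy, hG⟩ := hG
  have hb' : 1 / b ≠ 0 := by positivity
  have hax : MemLp (fun z => 1 / b * gx z) 2 area := hG.memLp_x.const_mul _
  -- With the weight `1 / b` on the `x` component, the inner product of two gradients is the
  -- bilinear form of the weak equation.
  let g : GradSpace := WithLp.toLp 2 (hax.toLp _, hG.memLp_y.toLp _)
  set K := (testGradients (1 / b)).topologicalClosure with hK
  have : CompleteSpace K := (Submodule.isClosed_topologicalClosure _).completeSpace_coe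
  -- Dirichlet's principle: subtracting the projection minimises the energy. The remainder `g - p`
  -- is the weighted gradient of `u = G - v`, and its orthogonality to test gradients is the weak
  -- equation.
  set p := K.starProjection g with hp
  have horth : g - p ∈ Kᗮ := K.sub_starProjection_mem_orthogonal g
  obtain ⟨v, vx, hv, hv0, hpx⟩ := exists_memH10_of_mem_closure hb'
    (show p ∈ (testGradients (1 / b)).topologicalClosure from K.starProjection_apply_mem g)
  have hu := hG.linear hv 1 (-1)
  refine ⟨fun z => 1 * G z + -1 * v z, ⟨_, _, hu⟩, ⟨_, _, hu, fun φ h => ?_⟩, ?_⟩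
  · have hφx : MemLp (fun z => 1 / b * dx φ z) 2 area := (h.dx_memLp 2).const_mul _
    let q : GradSpace := WithLp.toLp 2 (hφx.toLp _, (h.dy_memLp 2).toLp _)
    have hq : q ∈ K := (testGradients (1 / b)).le_topologicalClosure
      ⟨φ, h, hφx.coeFn_toLp, (h.dy_memLp 2).coeFn_toLp⟩
    have h0 := (Submodule.mem_orthogonal _ _).1 horth q hq
    rw [WithLp.prod_inner_apply, L2.inner_def, L2.inner_def, ← integral_add
      (L2.integrable_inner _ _) (L2.integrable_inner _ _)] at h0
    simp only [zero_mul, integral_zero, neg_zero]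
    rw [← h0]
    refine integral_congr_ae ?_
    filter_upwards [hφx.coeFn_toLp, (h.dy_memLp 2).coeFn_toLp, hax.coeFn_toLp,
      hG.memLp_y.coeFn_toLp, hpx, Lp.coeFn_sub (hax.toLp _) p.fst,
      Lp.coeFn_sub (hG.memLp_y.toLp _) p.snd] with z e1 e2 e3 e4 e5 e6 e7
    have f1 : (q.ofLp.1 : ℝ × ℝ → ℝ) z = 1 / b * dx φ z := e1
    have f2 : (q.ofLp.2 : ℝ × ℝ → ℝ) z = dy φ z := e2
    have f3 : ((g - p).ofLp.1 : ℝ × ℝ → ℝ) z = 1 / b * gx z - 1 / b * vx z := by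
      change (hax.toLp _ - p.fst : Lp ℝ 2 area) z = _
      rw [e6, Pi.sub_apply, e3, e5]
    have f4 : ((g - p).ofLp.2 : ℝ × ℝ → ℝ) z = gy z - p.snd z := by
      change (hG.memLp_y.toLp _ - p.snd : Lp ℝ 2 area) z = _
      rw [e7, Pi.sub_apply, e4]
    rw [f1, f2, f3, f4]
    simp
    field_simp
    ring
  · have := hv0.linear MemH10.zero (-1) 0
    convert this using 2
    ring

/-! ### Comparison by a barrier -/

theorem IsTest.integrable_mul {φ f : ℝ × ℝ → ℝ} (h : IsTest φ) (hf : Integrable f area) :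
    Integrable (fun z => f z * φ z) area := by
  obtain ⟨c, hc⟩ := h.compact.exists_bound_of_continuous h.smooth.continuous
  exact hf.mul_bdd h.smooth.continuous.aestronglyMeasurable (ae_of_all _ hc)

theorem SolvesWeakly.linear {b : ℝ} {u v f g : ℝ × ℝ → ℝ} (hu : SolvesWeakly b u f)
    (hv : SolvesWeakly b v g) (hf : Integrable f area) (hg : Integrable g area) (s t : ℝ) :
    SolvesWeakly b (fun z => s * u z + t * v z) (fun z => s * f z + t * g z) := by
  obtain ⟨ux, uy, hu, hu'⟩ := hu
  obtain ⟨vx, vy, hv, hv'⟩ := hv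
  refine ⟨_, _, hu.linear hv s t, fun φ h => ?_⟩
  have hi : ∀ {ux uy : ℝ × ℝ → ℝ}, MemLp ux 2 area → MemLp uy 2 area →
      Integrable (fun z => 1 / b ^ 2 * ux z * dx φ z + uy z * dy φ z) area := fun hx hy =>
    ((hx.const_mul (1 / b ^ 2)).integrable_mul (h.dx_memLp 2)).add
      (hy.integrable_mul (h.dy_memLp 2))
  have e1 : ∫ z, (1 / b ^ 2 * (s * ux z + t * vx z) * dx φ z +
      (s * uy z + t * vy z) * dy φ z) ∂area =
      s * ∫ z, (1 / b ^ 2 * ux z * dx φ z + uy z * dy φ z) ∂area +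
      t * ∫ z, (1 / b ^ 2 * vx z * dx φ z + vy z * dy φ z) ∂area := by
    rw [← integral_const_mul, ← integral_const_mul,
      ← integral_add ((hi hu.memLp_x hu.memLp_y).const_mul s)
        ((hi hv.memLp_x hv.memLp_y).const_mul t)]
    congr 1; ext z; ring
  have e2 : ∫ z, (s * f z + t * g z) * φ z ∂area =
      s * ∫ z, f z * φ z ∂area + t * ∫ z, g z * φ z ∂area := by
    rw [← integral_const_mul, ← integral_const_mul,
      ← integral_add ((h.integrable_mul hf).const_mul s) ((h.integrable_mul hg).const_mul t)]
    congr 1; ext z; ring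
  rw [e1, e2, hu' φ h, hv' φ h]; ring

theorem solvesWeakly_zero (b : ℝ) : SolvesWeakly b (fun _ => 0) fun _ => 0 :=
  ⟨_, _, HasH1Grad.zero, fun φ _ => by simp⟩

/-- The barrier `M / 2 * (1 - y²)` solves `b⁻² ∂ₓₓ h + ∂_yy h = -M`. -/
theorem solvesWeakly_barrier (b M : ℝ) :
    SolvesWeakly b (fun z => M / 2 * (1 - z.2 ^ 2)) fun _ => -M := by
  have hc : ContDiff ℝ 1 fun z : ℝ × ℝ => M / 2 * (1 - z.2 ^ 2) := by fun_prop
  have hd : ∀ z v : ℝ × ℝ, fderiv ℝ (fun z : ℝ × ℝ => M / 2 * (1 - z.2 ^ 2)) z v =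
      -M * z.2 * v.2 := fun z v => by
    have h1 : HasFDerivAt (fun z : ℝ × ℝ => M / 2 * (1 - z.2 ^ 2)) _ z :=
      (((hasFDerivAt_snd (𝕜 := ℝ) (p := z)).pow 2).const_sub 1).const_mul (M / 2)
    rw [h1.fderiv]; simp; ring
  refine ⟨_, _, HasH1Grad.of_contDiff hc, fun φ h => ?_⟩
  have hd' : ∀ z v : ℝ × ℝ, fderiv ℝ (fun z : ℝ × ℝ => -M * z.2) z v = -M * v.2 := fun z v => by
    have h1 : HasFDerivAt (fun z : ℝ × ℝ => -M * z.2) _ z :=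
      (hasFDerivAt_snd (𝕜 := ℝ) (p := z)).const_mul (-M)
    rw [h1.fderiv]; simp
  have h1 := h.integral_mul_fderiv (g := fun z => -M * z.2) (by fun_prop) (0, 1)
  simp only [hd'] at h1
  simp only [dx, dy, hd]
  simpa using h1

/-- One-sided comparison of two weak solutions with the same boundary values. -/
theorem SolvesWeakly.sub_le {b M : ℝ} {u v f f' g : ℝ × ℝ → ℝ} (hu : SolvesWeakly b u f)
    (hv : SolvesWeakly b v f') (hf : Integrable f area) (hf' : Integrable f' area)
    (hug : HasBoundaryValues u g) (hvg : HasBoundaryValues v g) (hM : 0 ≤ M)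
    (h : ∀ᵐ z ∂area, -M ≤ f z - f' z) : ∀ᵐ z ∂area, u z - v z ≤ M / 2 := by
  obtain ⟨G, hG, hGc, hGg, hG0⟩ := hug
  obtain ⟨H, hH, hHc, hHg, hH0⟩ := hvg
  have hbc : ContDiff ℝ 1 fun z : ℝ × ℝ => M / 2 * (1 - z.2 ^ 2) := by fun_prop
  -- The function `u - v - M / 2 * (1 - y²)` has right-hand side `f - f' + M ≥ 0`. Its boundary
  -- values are minus the barrier, which is nonnegative on the whole boundary though not zero on the
  -- sides `x = ±1`.
  have hs := (hu.linear hv hf hf' 1 (-1)).linear (solvesWeakly_barrier b M)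
    ((hf.const_mul 1).add (hf'.const_mul (-1))) (integrable_const _) 1 (-1)
  have key := hs.ae_le (K := 0)
    (G := fun z => 1 * (1 * G z + -1 * H z) + -1 * (M / 2 * (1 - z.2 ^ 2))) ?_
    ((hG.linear hH 1 (-1)).linear ⟨_, _, HasH1Grad.of_contDiff hbc⟩ 1 (-1)) ?_ ?_ ?_ ?_
  · filter_upwards [key] with z hz
    nlinarith [mul_nonneg hM (sq_nonneg z.2)]
  · exact (((hf.const_mul 1).add (hf'.const_mul (-1))).const_mul 1).add
      ((integrable_const _).const_mul (-1))
  · exact (((hGc.const_mul 1).add (hHc.const_mul (-1))).const_mul 1).add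
      (hbc.continuous.continuousOn.const_mul (-1))
  · intro z hz
    have hz2 := (frontier_subset_closure hz : z ∈ closure Omega)
    rw [closure_Omega] at hz2
    have h2 : z.2 ^ 2 ≤ 1 := by nlinarith [hz2.2.1, hz2.2.2]
    rw [hGg z hz, hHg z hz]
    nlinarith [mul_nonneg hM (sub_nonneg.2 h2)]
  · convert hG0.linear hH0 1 (-1) using 2
    ring
  · filter_upwards [h] with z hz _
    linarith

/-- A weak solution with boundary values in `[-K, K]`, whose right-hand side points outwards
outside `[-K, K]`, takes its values in `[-K, K]`. -/
theorem SolvesWeakly.abs_le {b K : ℝ} {u f g : ℝ × ℝ → ℝ} (hu : SolvesWeakly b u f)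
    (hf : Integrable f area) (hug : HasBoundaryValues u g) (hg : ∀ z ∈ frontier Omega, |g z| ≤ K)
    (h1 : ∀ᵐ z ∂area, K < u z → 0 ≤ f z) (h2 : ∀ᵐ z ∂area, u z < -K → f z ≤ 0) :
    ∀ᵐ z ∂area, |u z| ≤ K := by
  obtain ⟨G, hG, hGc, hGg, hG0⟩ := hug
  have k1 := hu.ae_le hf hG hGc (fun z hz => by
    rw [hGg z hz]; exact (le_abs_self _).trans (hg z hz)) hG0 h1
  -- The lower bound is the upper bound for `-u`.
  have k2 := (hu.linear (solvesWeakly_zero b) hf (integrable_zero _ _ _) (-1) 0).ae_le (K := K)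
    (G := fun z => -1 * G z + 0 * G z) (by simpa using hf.neg) (hG.linear hG (-1) 0)
    ((hGc.const_mul (-1)).add (hGc.const_mul 0))
    (fun z hz => by
      rw [hGg z hz]; linarith [(neg_le_abs (g z)).trans (hg z hz)])
    (by
      convert hG0.linear hG0 (-1) 0 using 2
      ring)
    (by
      filter_upwards [h2] with z hz hK
      linarith [hz (by linarith)])
  filter_upwards [k1, k2] with z e1 e2
  exact _root_.abs_le.2 ⟨by linarith, e1⟩

/-! ### Integrability of the cubic reaction term -/

theorem sq_mul_le_cube_add_cube {x y : ℝ} (hx : 0 ≤ x) (hy : 0 ≤ y) :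
    x ^ 2 * y ≤ x ^ 3 + y ^ 3 := by
  rcases le_total x y with h | h
  · nlinarith [pow_nonneg hx 3, mul_nonneg hy (mul_nonneg (sub_nonneg.2 h) (add_nonneg hx hy))]
  · nlinarith [pow_nonneg hy 3, mul_nonneg (sq_nonneg x) (sub_nonneg.2 h)]

/-- Before any sup bound is known, `L³` integrability of the components is what makes the cubic
products integrable. -/
theorem integrable_bulk_term {p q r : ℝ × ℝ → ℝ} (hp : MemLp p 3 area) (hq : MemLp q 3 area)
    (hr : MemLp r 3 area) (s k : ℝ) :
    Integrable (fun z => s * ((p z) ^ 2 + (q z) ^ 2 - k) * r z) area := by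
  have hc : ∀ {p : ℝ × ℝ → ℝ}, MemLp p 3 area → Integrable (fun z => ‖p z‖ ^ 3) area :=
    fun h => h.integrable_norm_pow (by norm_num)
  have h1 : ∀ {p : ℝ × ℝ → ℝ}, MemLp p 3 area → Integrable (fun z => p z ^ 2 * r z) area :=
    fun {p} h => by
    refine ((hc h).add (hc hr)).mono' ((h.1.pow 2).mul hr.1) (ae_of_all _ fun z => ?_)
    rw [norm_mul, norm_pow]
    exact sq_mul_le_cube_add_cube (norm_nonneg _) (norm_nonneg _)
  have h2 := (((h1 hp).add (h1 hq)).sub ((hr.integrable (by norm_num)).const_mul k)).const_mul s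
  refine h2.congr (ae_of_all _ fun z => ?_)
  simp; ring

/-! ### The boundary data -/

/-- The closed form holds on the whole line and makes the Lipschitz property visible. -/
theorem trapezoid_eq_min {ε : ℝ} (h0 : 0 < ε) (h1 : ε < 1 / 2) (t : ℝ) :
    trapezoid ε t = min 1 ((1 - |t|) / ε) := by
  rw [trapezoid]
  split_ifs with h h'
  · rw [abs_of_neg (by linarith), min_eq_right (by rw [div_le_one h0]; linarith)]; ring_nf
  · rw [min_eq_left]
    rw [le_div_iff₀ h0]
    have : |t| ≤ 1 - ε := _root_.abs_le.2 ⟨by linarith, h'⟩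
    linarith
  · rw [abs_of_pos (by linarith), min_eq_right (by rw [div_le_one h0]; linarith)]

theorem trapezoid_le_one {ε : ℝ} (h0 : 0 < ε) (h1 : ε < 1 / 2) (t : ℝ) : trapezoid ε t ≤ 1 := by
  rw [trapezoid_eq_min h0 h1]; exact min_le_left _ _

theorem trapezoid_nonneg {ε : ℝ} (h0 : 0 < ε) (h1 : ε < 1 / 2) {t : ℝ} (ht : |t| ≤ 1) :
    0 ≤ trapezoid ε t := by
  rw [trapezoid_eq_min h0 h1]; exact le_min zero_le_one (div_nonneg (by linarith) h0.le)

theorem trapezoid_eq_zero {ε : ℝ} (h0 : 0 < ε) (h1 : ε < 1 / 2) {t : ℝ} (ht : |t| = 1) :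
    trapezoid ε t = 0 := by
  rw [trapezoid_eq_min h0 h1, ht]; simp

theorem exists_lipschitzWith_trapezoid {ε : ℝ} (h0 : 0 < ε) (h1 : ε < 1 / 2) :
    ∃ c, LipschitzWith c (trapezoid ε) := by
  have h : LipschitzWith 1 fun t : ℝ => |t| := lipschitzWith_one_norm
  have h2 := ((lipschitzWith_smul ε⁻¹).comp ((LipschitzWith.const (1 : ℝ)).sub h)).const_min 1
  refine ⟨‖ε⁻¹‖₊ * (0 + 1), ?_⟩
  convert h2 using 2 with t
  rw [trapezoid_eq_min h0 h1, Function.comp_apply, smul_eq_mul, inv_mul_eq_div]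

theorem mem_frontier_Omega {z : ℝ × ℝ} (hz : z ∈ frontier Omega) :
    |z.1| ≤ 1 ∧ |z.2| ≤ 1 ∧ (|z.1| = 1 ∨ |z.2| = 1) := by
  rw [frontier, isOpen_Omega.interior_eq, closure_Omega] at hz
  obtain ⟨⟨h1, h2⟩, h3⟩ := hz
  have h1' := _root_.abs_le.2 h1
  have h2' := _root_.abs_le.2 h2
  refine ⟨h1', h2', ?_⟩
  by_contra! hh
  exact h3 ⟨abs_lt.1 (lt_of_le_of_ne h1' hh.1), abs_lt.1 (lt_of_le_of_ne h2' hh.2)⟩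

/-- A Lipschitz extension of the boundary data to the plane. -/
noncomputable def extension (B C ε : ℝ) (z : ℝ × ℝ) : ℝ := B / (2 * C) * (trapezoid ε z.1 - trapezoid ε z.2)

theorem exists_lipschitzWith_extension (B C : ℝ) {ε : ℝ} (h0 : 0 < ε) (h1 : ε < 1 / 2) :
    ∃ c, LipschitzWith c (extension B C ε) := by
  obtain ⟨c, hc⟩ := exists_lipschitzWith_trapezoid h0 h1
  exact ⟨_, (lipschitzWith_smul (B / (2 * C))).comp
    ((hc.comp LipschitzWith.prod_fst).sub (hc.comp LipschitzWith.prod_snd))⟩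

/-- On each side one of the two trapezoids in `extension` vanishes, and at the corners both do, so
one formula serves all sides. -/
theorem boundaryData_eq (B C : ℝ) {ε : ℝ} (h0 : 0 < ε) (h1 : ε < 1 / 2) {z : ℝ × ℝ}
    (hz : z ∈ frontier Omega) :
    boundaryData B C ε z = !![extension B C ε z, 0; 0, -extension B C ε z] := by
  obtain ⟨-, -, h⟩ := mem_frontier_Omega hz
  rw [boundaryData]
  split_ifs with hx
  · ext i j; fin_cases i <;> fin_cases j <;> simp [extension, trapezoid_eq_zero h0 h1 hx]
  · have hy := h.resolve_left hx
    ext i j; fin_cases i <;> fin_cases j <;> simp [extension, trapezoid_eq_zero h0 h1 hy]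

theorem abs_boundaryData_le {B C ε : ℝ} (hB : 0 < B) (hC : 0 < C) (h0 : 0 < ε) (h1 : ε < 1 / 2)
    {z : ℝ × ℝ} (hz : z ∈ frontier Omega) (i j : Fin 2) :
    |boundaryData B C ε z i j| ≤ B / (2 * C) := by
  have hK : 0 < B / (2 * C) := by positivity
  obtain ⟨hx, hy, -⟩ := mem_frontier_Omega hz
  have e : |extension B C ε z| ≤ B / (2 * C) := by
    rw [extension, abs_mul, abs_of_pos hK]
    refine mul_le_of_le_one_right hK.le (_root_.abs_le.2 ⟨?_, ?_⟩)
    · linarith [trapezoid_nonneg h0 h1 hx, trapezoid_le_one h0 h1 z.2]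
    · linarith [trapezoid_nonneg h0 h1 hy, trapezoid_le_one h0 h1 z.1]
  rw [boundaryData_eq B C h0 h1 hz]
  fin_cases i <;> fin_cases j <;> simp [e, hK.le]

/-! ### The linear limit and the `L^∞` estimates -/

theorem exists_isLinearSolution (B C : ℝ) {ε b : ℝ} (h0 : 0 < ε) (h1 : ε < 1 / 2) (hb : b ≠ 0) :
    ∃ P₀, IsLinearSolution B C ε b P₀ := by
  obtain ⟨c, hc⟩ := exists_lipschitzWith_extension B C h0 h1
  have hG := MemH1.of_lipschitz hc
  obtain ⟨u, hu, hs, hb0⟩ := exists_solvesWeakly hb hG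
  have hu' : MemH1 fun z => -u z := by simpa using hu.linear hu (-1) 0
  have hG' : MemH1 fun z => -extension B C ε z := by simpa using hG.linear hG (-1) 0
  have hz : MemH1 fun _ => 0 := ⟨_, _, HasH1Grad.zero⟩
  have hbd : ∀ i j, ∀ z ∈ frontier Omega, boundaryData B C ε z i j =
      (!![extension B C ε z, 0; 0, -extension B C ε z] : Matrix (Fin 2) (Fin 2) ℝ) i j :=
    fun i j z hz => by rw [boundaryData_eq B C h0 h1 hz]
  have hzero : MemH10 fun _ => (0 : ℝ) - 0 := by simpa using MemH10.zero
  -- The off-diagonal boundary data vanish, so zero solves that equation and only one scalar problem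
  -- remains.
  refine ⟨fun z => !![u z, 0; 0, -u z], ⟨fun i j => ?_, ae_of_all _ fun z => ⟨?_, ?_⟩,
    fun i j => ?_⟩, hs, solvesWeakly_zero b⟩
  · fin_cases i <;> fin_cases j <;> simp [hu, hu', hz]
  · ext i j; fin_cases i <;> fin_cases j <;> simp
  · simp [Matrix.trace_fin_two]
  · fin_cases i <;> fin_cases j
    · exact ⟨_, hG, hc.continuous.continuousOn, fun z hz => (hbd 0 0 z hz).symm, hb0⟩
    · exact ⟨_, hz, continuousOn_const, fun z hz => (hbd 0 1 z hz).symm, hzero⟩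
    · exact ⟨_, hz, continuousOn_const, fun z hz => (hbd 1 0 z hz).symm, hzero⟩
    · refine ⟨_, hG', hc.continuous.continuousOn.neg, fun z hz => (hbd 1 1 z hz).symm, ?_⟩
      convert hb0.linear hb0 (-1) 0 using 2
      simp; ring

/-- The maximum principle for the Euler–Lagrange system. -/
theorem IsELSolution.abs_le {B C ε b lam : ℝ} (hB : 0 < B) (hC : 0 < C) (h0 : 0 < ε)
    (h1 : ε < 1 / 2) {P : Field} (hP : IsELSolution B C ε b lam P) :
    (∀ᵐ z ∂area, |P z 0 0| ≤ B / (2 * C)) ∧ ∀ᵐ z ∂area, |P z 0 1| ≤ B / (2 * C) := by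
  obtain ⟨hA, hs0, hs1⟩ := hP
  have hp := (hA.boundary 0 0).memLp_three
  have hq := (hA.boundary 0 1).memLp_three
  have hK : 0 < B / (2 * C) := by positivity
  have hK2 : B ^ 2 / (4 * C ^ 2) = (B / (2 * C)) ^ 2 := by rw [div_pow]; ring
  -- Here `s` is the square of the other component. It only helps the sign, so each equation of the
  -- coupled system can be treated as a scalar one.
  have hout : ∀ {x s : ℝ}, 0 ≤ s → B / (2 * C) < |x| →
      0 ≤ lam ^ 2 * (x ^ 2 + s - B ^ 2 / (4 * C ^ 2)) := fun {x s} hs hx => by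
    refine mul_nonneg (sq_nonneg _) ?_
    rw [hK2, ← sq_abs x]
    nlinarith
  constructor
  · refine hs0.abs_le (integrable_bulk_term hp hq hp _ _) (hA.boundary 0 0)
      (fun z hz => abs_boundaryData_le hB hC h0 h1 hz 0 0) (ae_of_all _ fun z hz => ?_)
      (ae_of_all _ fun z hz => ?_)
    · exact mul_nonneg (hout (sq_nonneg _) (hz.trans_le (le_abs_self _))) (hK.trans hz).le
    · exact mul_nonpos_of_nonneg_of_nonpos
        (hout (sq_nonneg _) ((lt_neg.2 hz).trans_le (neg_le_abs _))) (by linarith)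
  · have hcomm : ∀ z, lam ^ 2 * ((P z 0 0) ^ 2 + (P z 0 1) ^ 2 - B ^ 2 / (4 * C ^ 2)) =
        lam ^ 2 * ((P z 0 1) ^ 2 + (P z 0 0) ^ 2 - B ^ 2 / (4 * C ^ 2)) := fun z => by ring
    refine hs1.abs_le (integrable_bulk_term hp hq hq _ _) (hA.boundary 0 1)
      (fun z hz => abs_boundaryData_le hB hC h0 h1 hz 0 1) (ae_of_all _ fun z hz => ?_)
      (ae_of_all _ fun z hz => ?_)
    · rw [hcomm]
      exact mul_nonneg (hout (sq_nonneg _) (hz.trans_le (le_abs_self _))) (hK.trans hz).le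
    · rw [hcomm]
      exact mul_nonpos_of_nonneg_of_nonpos
        (hout (sq_nonneg _) ((lt_neg.2 hz).trans_le (neg_le_abs _))) (by linarith)

/-- Bounding each component by `K` suffices: `p² + q²` lies in `[0, 2K²]`, so its distance to `K²`
is at most `K²`. -/
theorem abs_bulk_term_le {K p q r s : ℝ} (hp : |p| ≤ K) (hq : |q| ≤ K)
    (hr : |r| ≤ K) (hs : 0 ≤ s) : |s * (p ^ 2 + q ^ 2 - K ^ 2) * r| ≤ s * K ^ 3 := by
  have h1 : p ^ 2 ≤ K ^ 2 := sq_le_sq' (_root_.abs_le.1 hp).1 (_root_.abs_le.1 hp).2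
  have h2 : q ^ 2 ≤ K ^ 2 := sq_le_sq' (_root_.abs_le.1 hq).1 (_root_.abs_le.1 hq).2
  have h3 : |p ^ 2 + q ^ 2 - K ^ 2| ≤ K ^ 2 :=
    _root_.abs_le.2 ⟨by linarith [sq_nonneg p, sq_nonneg q], by linarith⟩
  rw [abs_mul, abs_mul, abs_of_nonneg hs, mul_assoc]
  refine mul_le_mul_of_nonneg_left ?_ hs
  calc |p ^ 2 + q ^ 2 - K ^ 2| * |r| ≤ K ^ 2 * K := by gcongr
    _ = K ^ 3 := by ring

theorem S0_apply {M : Matrix (Fin 2) (Fin 2) ℝ} (h : M ∈ S0) : M 1 0 = M 0 1 ∧ M 1 1 = -M 0 0 := by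
  obtain ⟨h1, h2⟩ := h
  rw [Matrix.trace_fin_two] at h2
  exact ⟨h1.apply 0 1, by linarith⟩

/-- On symmetric traceless matrices `tr(M²) = 2(M₁₁² + M₁₂²)`, so two entries of size `m / 2` give
exactly `m²`. -/
theorem tensorNorm_sub_le {M N : Matrix (Fin 2) (Fin 2) ℝ} (hM : M ∈ S0) (hN : N ∈ S0) {m : ℝ}
    (hm : 0 ≤ m) (h0 : |M 0 0 - N 0 0| ≤ m / 2) (h1 : |M 0 1 - N 0 1| ≤ m / 2) :
    tensorNorm (M - N) ≤ m := by
  obtain ⟨a1, a2⟩ := S0_apply hM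
  obtain ⟨b1, b2⟩ := S0_apply hN
  refine Real.sqrt_le_iff.2 ⟨hm, ?_⟩
  rw [Matrix.trace_fin_two]
  simp only [Matrix.mul_apply, Fin.sum_univ_two, Matrix.sub_apply, a1, a2, b1, b2]
  nlinarith [sq_le_sq' (_root_.abs_le.1 h0).1 (_root_.abs_le.1 h0).2,
    sq_le_sq' (_root_.abs_le.1 h1).1 (_root_.abs_le.1 h1).2]

/-- The `L^∞` estimate between Euler–Lagrange solutions and the linear limit. -/
theorem IsELSolution.linftyNorm_sub_le {B C ε b lam : ℝ} (hB : 0 < B) (hC : 0 < C) (h0 : 0 < ε)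
    (h1 : ε < 1 / 2) {P P₀ : Field} (hP : IsELSolution B C ε b lam P)
    (hP₀ : IsLinearSolution B C ε b P₀) :
    linftyNorm (P - P₀) ≤ ENNReal.ofReal ((B / (2 * C)) ^ 3 * lam ^ 2) := by
  obtain ⟨b0, b1⟩ := hP.abs_le hB hC h0 h1
  obtain ⟨hA, hs0, hs1⟩ := hP
  obtain ⟨hA', hl0, hl1⟩ := hP₀
  have hK2 : B ^ 2 / (4 * C ^ 2) = (B / (2 * C)) ^ 2 := by rw [div_pow]; ring
  have hm : 0 ≤ (B / (2 * C)) ^ 3 * lam ^ 2 := by positivity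
  have hp := (hA.boundary 0 0).memLp_three
  have hq := (hA.boundary 0 1).memLp_three
  have i0 : Integrable (fun _ => (0 : ℝ)) area := integrable_zero _ _ _
  rw [hK2] at hs0 hs1
  have i1 := integrable_bulk_term hp hq hp (lam ^ 2) ((B / (2 * C)) ^ 2)
  have i2 := integrable_bulk_term hp hq hq (lam ^ 2) ((B / (2 * C)) ^ 2)
  have f1 : ∀ᵐ z ∂area, |lam ^ 2 * ((P z 0 0) ^ 2 + (P z 0 1) ^ 2 - (B / (2 * C)) ^ 2) * P z 0 0| ≤
      (B / (2 * C)) ^ 3 * lam ^ 2 := by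
    filter_upwards [b0, b1] with z e0 e1
    rw [mul_comm (_ ^ 3)]; exact abs_bulk_term_le e0 e1 e0 (sq_nonneg lam)
  have f2 : ∀ᵐ z ∂area, |lam ^ 2 * ((P z 0 0) ^ 2 + (P z 0 1) ^ 2 - (B / (2 * C)) ^ 2) * P z 0 1| ≤
      (B / (2 * C)) ^ 3 * lam ^ 2 := by
    filter_upwards [b0, b1] with z e0 e1
    rw [mul_comm (_ ^ 3)]; exact abs_bulk_term_le e0 e1 e1 (sq_nonneg lam)
  -- The comparison is one-sided, so it is applied in both orders to each of the two components.
  have c1 := hs0.sub_le hl0 i1 i0 (hA.boundary 0 0) (hA'.boundary 0 0) hm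
    (f1.mono fun z hz => by linarith [(_root_.abs_le.1 hz).1])
  have c2 := hl0.sub_le hs0 i0 i1 (hA'.boundary 0 0) (hA.boundary 0 0) hm
    (f1.mono fun z hz => by linarith [(_root_.abs_le.1 hz).2])
  have c3 := hs1.sub_le hl1 i2 i0 (hA.boundary 0 1) (hA'.boundary 0 1) hm
    (f2.mono fun z hz => by linarith [(_root_.abs_le.1 hz).1])
  have c4 := hl1.sub_le hs1 i0 i2 (hA'.boundary 0 1) (hA.boundary 0 1) hm
    (f2.mono fun z hz => by linarith [(_root_.abs_le.1 hz).2])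
  refine essSup_le_of_ae_le _ ?_
  filter_upwards [c1, c2, c3, c4, hA.mem_S0, hA'.mem_S0] with z k1 k2 k3 k4 m1 m2
  exact ENNReal.ofReal_le_ofReal (tensorNorm_sub_le m1 m2 hm
    (_root_.abs_le.2 ⟨by linarith, k1⟩) (_root_.abs_le.2 ⟨by linarith, k3⟩))

/-- The comparison with `M = 0`, in both orders, forces the two independent entries to agree. -/
theorem IsLinearSolution.ae_eq {B C ε b : ℝ} {P Q : Field} (hP : IsLinearSolution B C ε b P)
    (hQ : IsLinearSolution B C ε b Q) : P =ᵐ[area] Q := by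
  obtain ⟨hA, hs0, hs1⟩ := hP
  obtain ⟨hA', hl0, hl1⟩ := hQ
  have i0 : Integrable (fun _ => (0 : ℝ)) area := integrable_zero _ _ _
  have hz : ∀ᵐ z ∂area, -(0 : ℝ) ≤ (fun _ : ℝ × ℝ => (0 : ℝ)) z - (fun _ => 0) z :=
    ae_of_all _ fun z => by simp
  have c1 := hs0.sub_le hl0 i0 i0 (hA.boundary 0 0) (hA'.boundary 0 0) le_rfl hz
  have c2 := hl0.sub_le hs0 i0 i0 (hA'.boundary 0 0) (hA.boundary 0 0) le_rfl hz
  have c3 := hs1.sub_le hl1 i0 i0 (hA.boundary 0 1) (hA'.boundary 0 1) le_rfl hz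
  have c4 := hl1.sub_le hs1 i0 i0 (hA'.boundary 0 1) (hA.boundary 0 1) le_rfl hz
  filter_upwards [c1, c2, c3, c4, hA.mem_S0, hA'.mem_S0] with z k1 k2 k3 k4 m1 m2
  obtain ⟨a1, a2⟩ := S0_apply m1
  obtain ⟨b1, b2⟩ := S0_apply m2
  have e0 : P z 0 0 = Q z 0 0 := by linarith
  have e1 : P z 0 1 = Q z 0 1 := by linarith
  ext i j
  fin_cases i <;> fin_cases j <;> simp [a1, a2, b1, b2, e0, e1]

end RLdG

theorem mainTheorem3 (B C : ℝ) (hB : 0 < B) (hC : 0 < C) :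
    ∃ Chat : ℝ, 0 < Chat ∧ ∀ ε : ℝ, 0 < ε → ε < 1 / 2 →
      -- for each aspect ratio: the unique limit `P₀`, the error estimate, the limit `lam → 0`
      (∀ b : ℝ, 1 < b → ∃ P₀ : RLdG.Field,
        RLdG.IsLinearSolution B C ε b P₀ ∧
        (∀ P₀' : RLdG.Field, RLdG.IsLinearSolution B C ε b P₀' → P₀' =ᵐ[RLdG.area] P₀) ∧
        (∀ lam : ℝ, 0 < lam → ∀ P : RLdG.Field, RLdG.IsELSolution B C ε b lam P →
          RLdG.linftyNorm (P - P₀) ≤ ENNReal.ofReal (Chat * lam ^ 2)) ∧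
        (∀ P : ℝ → RLdG.Field,
          (∀ᶠ lam in 𝓝[>] (0 : ℝ), RLdG.IsELSolution B C ε b lam (P lam)) →
          Tendsto (fun lam => RLdG.linftyNorm (P lam - P₀)) (𝓝[>] (0 : ℝ)) (𝓝 0))) ∧
      -- the limit `b → ∞` at fixed area `S = 4 lam² b`
      (∀ S : ℝ, 0 < S → ∀ P P₀ : ℝ → RLdG.Field,
        (∀ᶠ b in atTop, RLdG.IsELSolution B C ε b √(S / (4 * b)) (P b)) →
        (∀ᶠ b in atTop, RLdG.IsLinearSolution B C ε b (P₀ b)) →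
        Tendsto (fun b => RLdG.linftyNorm (P b - P₀ b)) atTop (𝓝 0)) := by
  -- The reaction term is at most `(B / (2 * C)) ^ 3 * λ²`; the half gained from the barrier is
  -- spent on the tensor norm.
  refine ⟨(B / (2 * C)) ^ 3, by positivity, fun ε h0 h1 => ⟨fun b hb => ?_, fun S hS P P₀ hP hP₀ => ?_⟩⟩
  · obtain ⟨P₀, hP₀⟩ := RLdG.exists_isLinearSolution B C h0 h1 (show b ≠ 0 by linarith)
    refine ⟨P₀, hP₀, fun Q hQ => hQ.ae_eq hP₀,
      fun lam _ P hP => hP.linftyNorm_sub_le hB hC h0 h1 hP₀, fun P hP => ?_⟩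
    have ht : Tendsto (fun lam : ℝ => ENNReal.ofReal ((B / (2 * C)) ^ 3 * lam ^ 2)) (𝓝[>] 0)
        (𝓝 0) := by
      have : Continuous fun lam : ℝ => ENNReal.ofReal ((B / (2 * C)) ^ 3 * lam ^ 2) :=
        ENNReal.continuous_ofReal.comp (by fun_prop)
      simpa using (this.tendsto 0).mono_left nhdsWithin_le_nhds
    exact tendsto_of_tendsto_of_tendsto_of_le_of_le' tendsto_const_nhds ht
      (Eventually.of_forall fun _ => zero_le)
      (hP.mono fun lam h => h.linftyNorm_sub_le hB hC h0 h1 hP₀)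
  -- The linear solution varies with `b`, but the estimate is uniform in `b`, so `λ² = S / (4b) → 0`
  -- is enough.
  · have ht : Tendsto (fun b : ℝ => ENNReal.ofReal ((B / (2 * C)) ^ 3 * √(S / (4 * b)) ^ 2)) atTop
        (𝓝 0) := by
      have h2 : Tendsto (fun b : ℝ => S / (4 * b)) atTop (𝓝 0) :=
        tendsto_const_nhds.div_atTop (tendsto_id.const_mul_atTop (by norm_num))
      have hc : Continuous fun x : ℝ => ENNReal.ofReal ((B / (2 * C)) ^ 3 * √x ^ 2) :=
        ENNReal.continuous_ofReal.comp (by fun_prop)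
      have h3 := (hc.tendsto 0).comp h2
      rwa [Real.sqrt_zero, zero_pow two_ne_zero, mul_zero, ENNReal.ofReal_zero] at h3
    refine tendsto_of_tendsto_of_tendsto_of_le_of_le' tendsto_const_nhds ht
      (Eventually.of_forall fun _ => zero_le) ?_
    filter_upwards [hP, hP₀] with b h h' using h.linftyNorm_sub_le hB hC h0 h1 h'
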